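/- **Setting.** Let $1\le d\le m$. Let $p_{\mathbf r}$ be a spherically symmetric probability distribution on $\mathbb R^m$ (invariant under every orthogonal map) with $p_{\mathbf r}(\{0\})=0$; for instance, any spherically symmetric distribution with a Lebesgue density. Let $0<\varepsilon<w$, where $w$ is the grid width, and put $p=\lceil 1/w\rceil+1$. Sample matrices $\mathbf J^{(1)},\dots,\mathbf J^{(p)}\in\mathbb R^{m\times d}$ whose $pd$ columns $\mathbf J^{(t)}_{:,k}$ are i.i.d. with law $p_{\mathbf r}$. Let $\tilde 1_\varepsilon:\mathbb R\to\mathbb R$ be the smooth step $$\tilde 1_\varepsilon(s)=\begin{cases}0,& s\le-\varepsilon,\\ \tfrac12\sin\!\big(\tfrac{\pi s}{2\varepsilon}\big)+\tfrac12,&-\varepsilon<s\le\varepsilon,\\ 1,& s>\varepsilon,\end{cases}$$ and define the smoothed grid-wise affine map $\tilde{\mathbf f}_\varepsilon(\mathbf s)=\sum_{k=1}^d\tilde{\mathbf f}_{\varepsilon,k}(s_k)$ on $[0,1]^d$ by $$\tilde{\mathbf f}_{\varepsilon,k}(x)=\sum_{t=1}^p\Big(\mathbf J^{(t)}_{:,k}\,(x-(t-1)w)+\sum_{i=1}^{t-1}\mathbf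 J^{(i)}_{:,k}\,w\Big)\big(\tilde 1_\varepsilon(x-(t-1)w)-\tilde 1_\varepsilon(x-tw)\big).$$ For a map $\mathbf f$ with Jacobian $\mathbf J_{\mathbf f}(\mathbf s)$, the local IMA contrast at a point where the Jacobian has full column rank is $$c_{\mathrm{IMA}}(\mathbf f,\mathbf s)=\sum_{k=1}^d\log\Big\|\frac{\partial\mathbf f}{\partial s_k}(\mathbf s)\Big\|-\tfrac12\log\det\big(\mathbf J_{\mathbf f}(\mathbf s)^\top\mathbf J_{\mathbf f}(\mathbf s)\big),$$ and for a probability density $p_{\mathbf s}$ on $[0,1]^d$ the global IMA contrast is $C_{\mathrm{IMA}}(\mathbf f,p_{\mathbf s})=\int_{[0,1]^d}c_{\mathrm{IMA}}(\mathbf f,\mathbf s)\,p_{\mathbf s}(\mathbf s)\,d\mathbf s$. We call it well defined if $\mathbf J_{\mathbf f}(\mathbf s)$ has full column rank for almost every $\mathbf s\in[0,1]^d$ and the integral converges absolutely. **Theorem.** For every $\delta_0>0$ there is a constant $\kappa>0$, depending only on $\delta_0$ (so an absolute constant for $\delta_0=\tfrac12$), such that for all $d,m,p_{\mathbf r},w,\varepsilon$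 as above, every real-valued probability density $p_{\mathbf s}$ on $[0,1]^d$, and every $0<\delta<\delta_0$, $$\Pr\big[\,C_{\mathrm{IMA}}(\tilde{\mathbf f}_\varepsilon,p_{\mathbf s})\text{ is well defined and }\le\delta\,\big]\;\ge\;1-\min\Big\{1,\exp\Big(2\log d-\kappa(m-1)\frac{\delta^2}{d^2}\Big)\Big\}.$$ -/

import Mathlib

open MeasureTheory

noncomputable section

/-- A law on `ℝᵐ` is spherically symmetric if it is invariant under every orthogonal map. -/
def IsSphericallySymmetric {m : ℕ} (pr : Measure (EuclideanSpace ℝ (Fin m))) : Prop :=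
  ∀ O : EuclideanSpace ℝ (Fin m) ≃ₗᵢ[ℝ] EuclideanSpace ℝ (Fin m), pr.map O = pr

/-- The cube `[0,1]^d`. -/
def unitCube (d : ℕ) : Set (Fin d → ℝ) := Set.Icc 0 1

/-- A (real-valued, so everywhere finite) probability density on `[0,1]^d`. -/
structure IsDensityOnCube {d : ℕ} (ps : (Fin d → ℝ) → ℝ) : Prop where
  measurable : Measurable ps
  nonneg : ∀ s ∈ unitCube d, 0 ≤ ps s
  integral_eq_one : ∫ s in unitCube d, ps s = 1

/-- The partial derivative `∂f/∂s_k (s)`, the `k`-th column of the Jacobian of `f` at `s`. -/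
def jacobianCol {d m : ℕ} (f : (Fin d → ℝ) → EuclideanSpace ℝ (Fin m)) (s : Fin d → ℝ)
    (k : Fin d) : EuclideanSpace ℝ (Fin m) :=
  fderiv ℝ f s (Pi.single k 1)

/-- The `m × d` Jacobian matrix of `f` at `s`. -/
def jacobian {d m : ℕ} (f : (Fin d → ℝ) → EuclideanSpace ℝ (Fin m)) (s : Fin d → ℝ) :
    Matrix (Fin m) (Fin d) ℝ :=
  Matrix.of fun i k => jacobianCol f s k i

/-- The local IMA contrast
`c(f, s) = ∑ₖ log ‖∂f/∂s_k (s)‖ - (1/2) log det (J_f(s)ᵀ J_f(s))`.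
It is meaningful where the Jacobian has full column rank. -/
def localIMA {d m : ℕ} (f : (Fin d → ℝ) → EuclideanSpace ℝ (Fin m)) (s : Fin d → ℝ) : ℝ :=
  ∑ k, Real.log ‖jacobianCol f s k‖
    - (1 / 2) * Real.log ((jacobian f s).transpose * jacobian f s).det

/-- The global IMA contrast `C(f, p) = ∫_{[0,1]^d} c(f, s) p(s) ds`. -/
def globalIMA {d m : ℕ} (f : (Fin d → ℝ) → EuclideanSpace ℝ (Fin m))
    (ps : (Fin d → ℝ) → ℝ) : ℝ :=
  ∫ s in unitCube d, localIMA f s * ps s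

/-- The global IMA contrast is a genuine finite number: the Jacobian has full column rank
at almost every point of the cube, and the local contrast is integrable against the density. -/
structure GlobalIMAWellDefined {d m : ℕ} (f : (Fin d → ℝ) → EuclideanSpace ℝ (Fin m))
    (ps : (Fin d → ℝ) → ℝ) : Prop where
  fullRank : ∀ᵐ s ∂(volume.restrict (unitCube d)), LinearIndependent ℝ (jacobianCol f s)
  integrable : IntegrableOn (fun s => localIMA f s * ps s) (unitCube d)

/-- The sinusoidal smooth step function. -/
def smoothStep (ε s : ℝ) : ℝ :=
  if s ≤ -ε then 0
  else if s ≤ ε then (1 / 2) * Real.sin (Real.pi * s / (2 * ε)) + 1 / 2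
  else 1

/-- The number `p = ⌈1/w⌉ + 1` of grid parts along one dimension, for grid width `w`. -/
def gridParts (w : ℝ) : ℕ := ⌈1 / w⌉₊ + 1

/-- The columns of the matrices `J⁽¹⁾, …, J⁽ᵖ⁾ ∈ ℝ^{m × d}`: `J (t, k)` is the `k`-th column of
the matrix number `t + 1` (indices in `Fin` start at zero). -/
abbrev GridColumns (d m : ℕ) (w : ℝ) : Type :=
  Fin (gridParts w) × Fin d → EuclideanSpace ℝ (Fin m)

/-- The sampling law: all the columns are independent with law `pr`. -/
def gridLaw (d : ℕ) {m : ℕ} (w : ℝ) (pr : Measure (EuclideanSpace ℝ (Fin m)))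
    [IsProbabilityMeasure pr] : Measure (GridColumns d m w) :=
  Measure.pi fun _ => pr

/-- The `k`-th coordinate-wise function of the smoothed grid-wise affine map. As `t` starts at
zero, part number `t + 1` is `(t w, (t + 1) w]`. -/
def smoothGridCoord {d m : ℕ} {w : ℝ} (ε : ℝ) (J : GridColumns d m w) (k : Fin d) (x : ℝ) :
    EuclideanSpace ℝ (Fin m) :=
  ∑ t : Fin (gridParts w),
    (smoothStep ε (x - (t : ℝ) * w) - smoothStep ε (x - ((t : ℝ) + 1) * w)) •
      ((x - (t : ℝ) * w) • J (t, k) + ∑ i ∈ Finset.Iio t, w • J (i, k))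

/-- The smoothed grid-wise affine map, the sum of its coordinate-wise functions. -/
def smoothGridMap {d m : ℕ} {w : ℝ} (ε : ℝ) (J : GridColumns d m w) (s : Fin d → ℝ) :
    EuclideanSpace ℝ (Fin m) :=
  ∑ k, smoothGridCoord ε J k (s k)

end

/-! ### Radial moments and projections of the standard Gaussian -/

section GaussianMoments

open ProbabilityTheory Module

variable {E : Type*} [NormedAddCommGroup E] [InnerProductSpace ℝ E] [FiniteDimensional ℝ E]
  [MeasurableSpace E] [BorelSpace E]

/-! At almost every `s` the `k`-th Jacobian column is a combination `∑ a t • J (t, k)`. The columns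
are independent and spherically symmetric. For `2 ≤ m` none has an atom at `0`, because the
coefficients of each column add up to at least `1/2`. By Gram–Schmidt the contrast of columns `v k`
is `∑ log (‖v k‖ / ‖g k‖)`, where `g k` is the part of `v k` orthogonal to the earlier columns. It
is small because, for `m` large, a random direction is nearly orthogonal to a fixed subspace of
small dimension.

Quantitatively, `exp (2 l · contrast)` is the product of the `(‖g k‖² / ‖v k‖²)⁻ˡ`. Given the
earlier columns, such a factor depends only on the direction of `v k`, which is distributed as for a
Gaussian vector. Its mean is then at most a quotient of Gamma functions, bounded by `exp (2 l k /
m)` (`IsSphericallySymmetric.lintegral_inv_ratio_pow_le`), and the bounds multiply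
(`lintegral_contrastWeight_le`).

The moment bound is uniform in `s`, so Tonelli, Markov and Jensen give the failure probability `exp
(∑ 2 l k / m - 2 l δ)` (`one_sub_exp_le_measureReal_globalIMA_le`). With `l` of order `m δ / d²` and
`d ≥ 2`, the sum stays below `1 < 2 log d` (`exists_moment_order`). For `d = 1` it vanishes. -/

theorem stdGaussian_eq_withDensity :
    ∃ c : ℝ, 0 < c ∧ stdGaussian E =
      volume.withDensity fun x => ENNReal.ofReal (c * Real.exp (-(1 / 2) * ‖x‖ ^ 2)) := by
  set I : ℝ := ∫ x : E, Real.exp (-(1 / 2) * ‖x‖ ^ 2) with hI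
  have hIval : I = (Real.pi / (1 / 2)) ^ (finrank ℝ E / 2 : ℝ) :=
    GaussianFourier.integral_rexp_neg_mul_sq_norm (by norm_num)
  have hIpos : 0 < I := by rw [hIval]; positivity
  -- The integral of a non-integrable function is `0` by convention, so a positive value proves
  -- integrability.
  have hint : Integrable fun x : E => Real.exp (-(1 / 2) * ‖x‖ ^ 2) := by
    by_contra h
    rw [hI, integral_undef h] at hIpos
    exact lt_irrefl _ hIpos
  refine ⟨I⁻¹, inv_pos.2 hIpos, ?_⟩
  set ν : Measure E :=
    volume.withDensity fun x => ENNReal.ofReal (I⁻¹ * Real.exp (-(1 / 2) * ‖x‖ ^ 2)) with hν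
  have hfin : IsFiniteMeasure ν := isFiniteMeasure_withDensity_ofReal (hint.const_mul _).2
  refine Measure.ext_of_charFun ?_
  funext t
  rw [charFun_stdGaussian, charFun_apply, hν,
    integral_withDensity_eq_integral_toReal_smul (by fun_prop)
      (Filter.Eventually.of_forall fun _ => ENNReal.ofReal_lt_top)]
  have h1 : ∀ x : E, (ENNReal.ofReal (I⁻¹ * Real.exp (-(1 / 2) * ‖x‖ ^ 2))).toReal •
      Complex.exp (inner ℝ x t * Complex.I) =
      ((I⁻¹ : ℝ) : ℂ) * Complex.exp (-(1 / 2 : ℂ) * ‖x‖ ^ 2 + Complex.I * inner ℝ t x) := by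
    intro x
    rw [ENNReal.toReal_ofReal (by positivity), Complex.real_smul, Complex.exp_add,
      real_inner_comm x t]
    push_cast
    ring_nf
  simp_rw [h1]
  rw [integral_const_mul,
    GaussianFourier.integral_cexp_neg_mul_sq_norm_add (b := (1 / 2 : ℂ)) (by norm_num)]
  have h2 : ((Real.pi : ℂ) / (1 / 2)) ^ (finrank ℝ E / 2 : ℂ) = (I : ℂ) := by
    rw [hIval, Complex.ofReal_cpow (by positivity)]
    push_cast
    rfl
  rw [h2, ← mul_assoc, ← Complex.ofReal_mul, inv_mul_cancel₀ hIpos.ne']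
  simp only [Complex.ofReal_one, one_mul, Complex.I_sq]
  congr 1
  ring

/-- Polar coordinates. One constant serves every `g`, so it can be determined from `g = 1` and never
has to be computed from the volume of the ball. -/
theorem lintegral_stdGaussian_fun_norm [Nontrivial E] :
    ∃ c : ℝ, 0 < c ∧ ∀ g : ℝ → ℝ, Measurable g → (∀ y, 0 ≤ g y) →
      IntegrableOn (fun y : ℝ => y ^ (finrank ℝ E - 1) • (Real.exp (-(1 / 2) * y ^ 2) * g y))
        (Set.Ioi 0) →
      ∫⁻ x, ENNReal.ofReal (g ‖x‖) ∂(stdGaussian E) =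
        ENNReal.ofReal (c * ∫ y in Set.Ioi (0 : ℝ),
          y ^ (finrank ℝ E - 1) • (Real.exp (-(1 / 2) * y ^ 2) * g y)) := by
  obtain ⟨c, hc, hG⟩ := stdGaussian_eq_withDensity (E := E)
  have hn : 0 < finrank ℝ E := finrank_pos
  have hB : 0 < (volume : Measure E).real (Metric.ball 0 1) :=
    ENNReal.toReal_pos (Metric.measure_ball_pos _ _ one_pos).ne' measure_ball_lt_top.ne
  refine ⟨c * (finrank ℝ E * (volume : Measure E).real (Metric.ball 0 1)), by positivity, ?_⟩
  intro g hg hg0 hint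
  have hint' : Integrable (fun x : E => Real.exp (-(1 / 2) * ‖x‖ ^ 2) * g ‖x‖) :=
    (integrable_fun_norm_addHaar volume
      (f := fun y : ℝ => Real.exp (-(1 / 2) * y ^ 2) * g y)).2 hint
  have hval := integral_fun_norm_addHaar (volume : Measure E)
    (fun y : ℝ => Real.exp (-(1 / 2) * y ^ 2) * g y)
  rw [hG, lintegral_withDensity_eq_lintegral_mul _ (by fun_prop) (by fun_prop)]
  have h1 : ∀ x : E, ((fun x : E => ENNReal.ofReal (c * Real.exp (-(1 / 2) * ‖x‖ ^ 2))) *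
      fun x : E => ENNReal.ofReal (g ‖x‖)) x =
      ENNReal.ofReal (c * (Real.exp (-(1 / 2) * ‖x‖ ^ 2) * g ‖x‖)) := by
    intro x
    rw [Pi.mul_apply, ← ENNReal.ofReal_mul (by positivity), mul_assoc]
  simp_rw [h1]
  rw [← ofReal_integral_eq_lintegral_ofReal (hint'.const_mul c)
    (Filter.Eventually.of_forall fun x => by have := hg0 ‖x‖; positivity), integral_const_mul, hval]
  congr 1
  simp only [nsmul_eq_mul, smul_eq_mul]
  ring

theorem stdGaussian_singleton_zero [Nontrivial E] : stdGaussian E {0} = 0 := by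
  obtain ⟨c, hc, hG⟩ := stdGaussian_eq_withDensity (E := E)
  rw [hG]
  exact withDensity_absolutelyContinuous _ _ (measure_singleton _)

/-- Negative moments of the norm of a standard Gaussian vector. -/
theorem lintegral_stdGaussian_inv_normSq_pow (l : ℕ) (hl : 2 * l < finrank ℝ E) :
    ∫⁻ x, ((ENNReal.ofReal (‖x‖ ^ 2)) ^ l)⁻¹ ∂(stdGaussian E) =
      ENNReal.ofReal ((2 ^ l)⁻¹ * Real.Gamma ((finrank ℝ E : ℝ) / 2 - l) /
        Real.Gamma ((finrank ℝ E : ℝ) / 2)) := by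
  have hn : 0 < finrank ℝ E := by omega
  have : Nontrivial E := Module.nontrivial_of_finrank_pos hn
  obtain ⟨c, hc, hg⟩ := lintegral_stdGaussian_fun_norm (E := E)
  set n := finrank ℝ E with hndef
  have key : ∀ i : ℕ, 2 * i < n →
      IntegrableOn (fun y : ℝ => y ^ (n - 1) • (Real.exp (-(1 / 2) * y ^ 2) * ((y ^ 2) ^ i)⁻¹))
        (Set.Ioi 0) ∧
      ∫ y in Set.Ioi (0 : ℝ), y ^ (n - 1) • (Real.exp (-(1 / 2) * y ^ 2) * ((y ^ 2) ^ i)⁻¹) =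
        2 ^ ((n : ℝ) / 2) * (2 ^ i)⁻¹ * (1 / 2) * Real.Gamma ((n : ℝ) / 2 - i) := by
    intro i hi
    have hi' : (2 : ℝ) * i < n := by exact_mod_cast hi
    have hcong : ∀ y ∈ Set.Ioi (0 : ℝ),
        y ^ ((n : ℝ) - 1 - 2 * i) * Real.exp (-(1 / 2) * y ^ (2 : ℝ)) =
        y ^ (n - 1) • (Real.exp (-(1 / 2) * y ^ 2) * ((y ^ 2) ^ i)⁻¹) := by
      intro y hy
      have hy : 0 < y := hy
      have e : ((n - 1 : ℕ) : ℝ) = (n : ℝ) - 1 := by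
        rw [Nat.cast_sub hn]; simp
      have e2 : (2 : ℝ) * i = ((2 * i : ℕ) : ℝ) := by push_cast; ring
      rw [Real.rpow_sub hy, ← e, Real.rpow_natCast, e2, Real.rpow_natCast, smul_eq_mul,
        Real.rpow_two, ← pow_mul, div_eq_mul_inv]
      ring
    constructor
    · refine IntegrableOn.congr_fun ?_ hcong measurableSet_Ioi
      simpa [Real.rpow_two] using (integrableOn_rpow_mul_exp_neg_mul_sq
        (b := (1 / 2 : ℝ)) (s := (n : ℝ) - 1 - 2 * i) (by norm_num) (by linarith))
    · rw [← setIntegral_congr_fun measurableSet_Ioi hcong,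
        integral_rpow_mul_exp_neg_mul_rpow (by norm_num) (by linarith) (by norm_num)]
      have e1 : ((n : ℝ) - 1 - 2 * i + 1) / 2 = (n : ℝ) / 2 - i := by ring
      have e3 : (-((n : ℝ) - 1 - 2 * i + 1) / 2) = -((n : ℝ) / 2 - i) := by ring
      rw [e3, e1, one_div, Real.inv_rpow (by norm_num), Real.rpow_neg (by norm_num), inv_inv,
        Real.rpow_sub (by norm_num), Real.rpow_natCast]
      ring
  have h0 := key 0 (by omega)
  have h1 := key l hl
  have hone := hg (fun y => ((y ^ 2) ^ 0)⁻¹) (by fun_prop) (fun y => by positivity) h0.1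
  rw [h0.2] at hone
  have hl' : (2 : ℝ) * l < n := by exact_mod_cast hl
  have hn' : (0 : ℝ) < n := by exact_mod_cast hn
  have hΓ : 0 < Real.Gamma ((n : ℝ) / 2) := Real.Gamma_pos_of_pos (by positivity)
  -- Total mass one, the case of exponent `0`, determines `c`.
  have hc1 : c * (2 ^ ((n : ℝ) / 2) * (1 / 2) * Real.Gamma ((n : ℝ) / 2)) = 1 := by
    simp only [pow_zero, inv_one, ENNReal.ofReal_one, lintegral_const, measure_univ, mul_one,
      Nat.cast_zero, sub_zero] at hone
    exact (ENNReal.ofReal_eq_one.1 hone.symm)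
  have hl1 := hg (fun y => ((y ^ 2) ^ l)⁻¹) (by fun_prop) (fun y => by positivity) h1.1
  rw [h1.2] at hl1
  have hae : ∀ᵐ x ∂(stdGaussian E), x ≠ 0 := by
    rw [ae_iff]; simpa using stdGaussian_singleton_zero
  rw [lintegral_congr_ae (g := fun x => ENNReal.ofReal (((‖x‖ ^ 2) ^ l)⁻¹)), hl1]
  · congr 1
    have h2 : (0 : ℝ) < 2 ^ ((n : ℝ) / 2) := by positivity
    rw [eq_div_iff hΓ.ne']
    calc _ = (c * (2 ^ ((n : ℝ) / 2) * (1 / 2) * Real.Gamma ((n : ℝ) / 2))) *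
          ((2 ^ l)⁻¹ * Real.Gamma ((n : ℝ) / 2 - l)) := by ring
      _ = _ := by rw [hc1, one_mul]
  · filter_upwards [hae] with x hx
    have : 0 < ‖x‖ := norm_pos_iff.2 hx
    rw [ENNReal.ofReal_inv_of_pos (by positivity), ← ENNReal.ofReal_pow (by positivity)]

/-- By the functional equation the quotient at `x` is `∏ 1 / (x - 2 i)` over `1 ≤ i ≤ l`. As `n - 2
i ≥ m / 2`, each factor changes by `(m - 2 i) / (n - 2 i) ≤ 1 + 2 (m - n) / m ≤ exp (2 (m - n) /
m)`. -/
theorem Gamma_shift_ratio_le {m n : ℝ} (l : ℕ) (hn : 0 < n) (hnm : n ≤ m)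
    (hl : m / 2 ≤ n - 2 * l) :
    (2 ^ l)⁻¹ * Real.Gamma (n / 2 - l) / Real.Gamma (n / 2) ≤
      Real.exp (2 * l * (m - n) / m) *
        ((2 ^ l)⁻¹ * Real.Gamma (m / 2 - l) / Real.Gamma (m / 2)) := by
  induction l with
  | zero =>
    have h1 : Real.Gamma (n / 2) ≠ 0 := (Real.Gamma_pos_of_pos (by positivity)).ne'
    have h2 : Real.Gamma (m / 2) ≠ 0 := (Real.Gamma_pos_of_pos (by linarith)).ne'
    simp [h1, h2]
  | succ l ih =>
    have hm : 0 < m := hn.trans_le hnm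
    push_cast at hl ⊢
    have ih := ih (by linarith)
    have step : ∀ x : ℝ, 0 < x / 2 - (l + 1) →
        (2 ^ (l + 1))⁻¹ * Real.Gamma (x / 2 - (l + 1)) / Real.Gamma (x / 2) =
        ((2 ^ l)⁻¹ * Real.Gamma (x / 2 - l) / Real.Gamma (x / 2)) / (x - 2 * (l + 1)) := by
      intro x hx
      have h : Real.Gamma (x / 2 - l) =
          (x / 2 - (l + 1)) * Real.Gamma (x / 2 - (l + 1)) := by
        rw [← Real.Gamma_add_one hx.ne']; ring_nf
      have h3 : x - 2 * (l + 1) ≠ 0 := by intro h; linarith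
      rw [h, pow_succ]
      field_simp
    have hmn : 0 < n - 2 * (l + 1) := by linarith
    have hmm : 0 < m - 2 * (l + 1) := by linarith
    rw [step n (by linarith), step m (by linarith)]
    have hA : 0 ≤ (2 ^ l)⁻¹ * Real.Gamma (m / 2 - l) / Real.Gamma (m / 2) := by
      have := Real.Gamma_pos_of_pos (show 0 < m / 2 - l by linarith)
      have := Real.Gamma_pos_of_pos (show 0 < m / 2 by linarith)
      positivity
    rw [div_le_iff₀ hmn]
    refine ih.trans ?_
    have hexp : Real.exp (2 * (l + 1) * (m - n) / m) =
        Real.exp (2 * l * (m - n) / m) * Real.exp (2 * (m - n) / m) := by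
      rw [← Real.exp_add]; congr 1; ring
    have hr : (m - 2 * (l + 1)) / (n - 2 * (l + 1)) ≤ Real.exp (2 * (m - n) / m) := by
      refine le_trans ?_ (Real.add_one_le_exp _)
      rw [div_le_iff₀ hmn, div_add_one hm.ne', div_mul_eq_mul_div, le_div_iff₀ hm]
      nlinarith
    rw [hexp]
    rw [div_le_iff₀ hmn] at hr
    calc _ = Real.exp (2 * l * (m - n) / m) *
          (((2 ^ l)⁻¹ * Real.Gamma (m / 2 - l) / Real.Gamma (m / 2)) / (m - 2 * (l + 1))) *
            (m - 2 * (l + 1)) := by field_simp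
      _ ≤ Real.exp (2 * l * (m - n) / m) *
          (((2 ^ l)⁻¹ * Real.Gamma (m / 2 - l) / Real.Gamma (m / 2)) / (m - 2 * (l + 1))) *
            (Real.exp (2 * (m - n) / m) * (n - 2 * (l + 1))) := by gcongr
      _ = _ := by ring

/-- The orthogonal projection of a standard Gaussian vector is a standard Gaussian vector. -/
theorem stdGaussian_map_orthogonalProjectionOnto (V : Submodule ℝ E) :
    (stdGaussian E).map V.orthogonalProjectionOnto = stdGaussian V := by
  have : IsProbabilityMeasure ((stdGaussian E).map V.orthogonalProjectionOnto) :=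
    Measure.isProbabilityMeasure_map (by fun_prop)
  refine Measure.ext_of_charFun ?_
  funext t
  rw [charFun_stdGaussian, charFun_apply, integral_map (by fun_prop) (by fun_prop)]
  have h : ∀ x : E, inner ℝ (V.orthogonalProjectionOnto x) t = inner ℝ x (t : E) := by
    intro x
    exact Submodule.inner_orthogonalProjectionOnto_eq_of_mem_right t x
  simp_rw [h]
  rw [← charFun_apply, charFun_stdGaussian]
  rfl

end GaussianMoments

/-! ### Directions of spherically symmetric vectors -/

section Spherical

open ProbabilityTheory Module

variable {m : ℕ} {μ ν : Measure (EuclideanSpace ℝ (Fin m))}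

theorem exists_linearIsometryEquiv_apply_eq {x y : EuclideanSpace ℝ (Fin m)} (h : ‖x‖ = ‖y‖) :
    ∃ O : EuclideanSpace ℝ (Fin m) ≃ₗᵢ[ℝ] EuclideanSpace ℝ (Fin m), O x = y :=
  ⟨_, Submodule.reflection_sub h⟩

theorem IsSphericallySymmetric.integral_comp {F : Type*} [NormedAddCommGroup F] [NormedSpace ℝ F]
    (hμ : IsSphericallySymmetric μ)
    (O : EuclideanSpace ℝ (Fin m) ≃ₗᵢ[ℝ] EuclideanSpace ℝ (Fin m))
    (f : EuclideanSpace ℝ (Fin m) → F) : ∫ x, f (O x) ∂μ = ∫ x, f x ∂μ := by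
  conv_rhs => rw [← hμ O]
  exact (integral_map_equiv O.toMeasurableEquiv f).symm

theorem measurable_normalize :
    Measurable fun x : EuclideanSpace ℝ (Fin m) => ‖x‖⁻¹ • x := by fun_prop

theorem IsSphericallySymmetric.charFun_direction_eq (hμ : IsSphericallySymmetric μ)
    {s t : EuclideanSpace ℝ (Fin m)} (hst : ‖s‖ = ‖t‖) :
    ∫ x, Complex.exp (inner ℝ (‖x‖⁻¹ • x) s * Complex.I) ∂μ =
      ∫ x, Complex.exp (inner ℝ (‖x‖⁻¹ • x) t * Complex.I) ∂μ := by
  obtain ⟨O, rfl⟩ := exists_linearIsometryEquiv_apply_eq hst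
  rw [← hμ.integral_comp O fun x => Complex.exp (inner ℝ (‖x‖⁻¹ • x) (O s) * Complex.I)]
  simp only [O.norm_map, ← map_smul, O.inner_map_map]

/-- The characteristic function of the direction depends only on `‖t‖`, so `t` may be replaced by
`‖t‖` times the direction of `y` and averaged over `y`. The resulting kernel is symmetric in `x` and
`y`, so Fubini can exchange the two laws. -/
theorem IsSphericallySymmetric.charFun_direction_eq_integral [IsProbabilityMeasure ν]
    (hμ : IsSphericallySymmetric μ)
    (hν0 : ν {0} = 0) (t : EuclideanSpace ℝ (Fin m)) :
    ∫ x, Complex.exp (inner ℝ (‖x‖⁻¹ • x) t * Complex.I) ∂μ =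
      ∫ y, ∫ x, Complex.exp
        (((‖t‖ * inner ℝ (‖x‖⁻¹ • x) (‖y‖⁻¹ • y) : ℝ) : ℂ) * Complex.I) ∂μ ∂ν := by
  have hae : ∀ᵐ y ∂ν, y ≠ 0 := by rw [ae_iff]; simpa using hν0
  symm
  rw [integral_congr_ae (g := fun _ =>
    ∫ x, Complex.exp (inner ℝ (‖x‖⁻¹ • x) t * Complex.I) ∂μ)]
  · simp
  · filter_upwards [hae] with y hy
    have hy : ‖y‖ ≠ 0 := norm_ne_zero_iff.2 hy
    rw [hμ.charFun_direction_eq (s := t) (t := ‖t‖ • (‖y‖⁻¹ • y))]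
    · simp only [inner_smul_right]
    · simp [norm_smul, hy]

/-- The direction of a spherically symmetric vector without atom at `0` has a unique law. -/
theorem IsSphericallySymmetric.map_direction_eq [IsProbabilityMeasure μ] [IsProbabilityMeasure ν]
    (hμ : IsSphericallySymmetric μ) (hν : IsSphericallySymmetric ν)
    (hμ0 : μ {0} = 0) (hν0 : ν {0} = 0) :
    μ.map (fun x => ‖x‖⁻¹ • x) = ν.map (fun x => ‖x‖⁻¹ • x) := by
  have : IsProbabilityMeasure (μ.map fun x => ‖x‖⁻¹ • x) :=
    Measure.isProbabilityMeasure_map measurable_normalize.aemeasurable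
  have : IsProbabilityMeasure (ν.map fun x => ‖x‖⁻¹ • x) :=
    Measure.isProbabilityMeasure_map measurable_normalize.aemeasurable
  refine Measure.ext_of_charFun ?_
  funext t
  rw [charFun_apply, charFun_apply, integral_map measurable_normalize.aemeasurable (by fun_prop),
    integral_map measurable_normalize.aemeasurable (by fun_prop),
    hμ.charFun_direction_eq_integral hν0, hν.charFun_direction_eq_integral hμ0,
    integral_integral_swap]
  · simp only [real_inner_comm]
  · refine Integrable.of_bound (C := 1) ?_ (Filter.Eventually.of_forall fun z => ?_)
    · refine Measurable.aestronglyMeasurable ?_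
      unfold Function.uncurry
      fun_prop
    · simp only [Function.uncurry]
      rw [Complex.norm_exp_ofReal_mul_I]

theorem isSphericallySymmetric_stdGaussian :
    IsSphericallySymmetric (stdGaussian (EuclideanSpace ℝ (Fin m))) :=
  fun O => stdGaussian_map O

/-- Reweighting by a function of the norm changes only the radial law. This allows a Gaussian to be
tilted without changing the law of its direction. -/
theorem IsSphericallySymmetric.withDensity_norm (hμ : IsSphericallySymmetric μ)
    {w : ℝ → ENNReal} (hw : Measurable w) :
    IsSphericallySymmetric (μ.withDensity fun x => w ‖x‖) := by
  intro O
  ext s hs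
  have hO : Measurable O := O.continuous.measurable
  rw [Measure.map_apply hO hs, withDensity_apply _ (hO hs), withDensity_apply _ hs]
  conv_rhs => rw [← hμ O]
  rw [setLIntegral_map hs (by fun_prop) hO]
  simp

theorem IsSphericallySymmetric.smul (hμ : IsSphericallySymmetric μ) (c : ENNReal) :
    IsSphericallySymmetric (c • μ) := by
  intro O
  rw [Measure.map_smul, hμ O]

theorem lintegral_stdGaussian_inv_projection_pow (V : Submodule ℝ (EuclideanSpace ℝ (Fin m)))
    (l : ℕ) (hl : 2 * l + finrank ℝ V < m) :
    ∫⁻ x, ((ENNReal.ofReal (‖Vᗮ.starProjection x‖ ^ 2)) ^ l)⁻¹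
        ∂(stdGaussian (EuclideanSpace ℝ (Fin m))) =
      ENNReal.ofReal ((2 ^ l)⁻¹ * Real.Gamma (((m : ℝ) - finrank ℝ V) / 2 - l) /
        Real.Gamma (((m : ℝ) - finrank ℝ V) / 2)) := by
  have hfr : finrank ℝ V + finrank ℝ Vᗮ = m := by
    rw [V.finrank_add_finrank_orthogonal]; simp
  have hcast : (finrank ℝ Vᗮ : ℝ) = (m : ℝ) - finrank ℝ V := by
    rw [eq_sub_iff_add_eq]; exact_mod_cast (by omega)
  rw [← hcast, ← lintegral_stdGaussian_inv_normSq_pow l (by omega),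
    ← stdGaussian_map_orthogonalProjectionOnto, lintegral_map (by fun_prop) (by fun_prop)]
  rfl

/-- Negative moments of the sine of the angle between a spherically symmetric vector and a fixed
subspace. -/
theorem IsSphericallySymmetric.lintegral_inv_ratio_pow_le [IsProbabilityMeasure μ]
    (hμ : IsSphericallySymmetric μ) (hμ0 : μ {0} = 0)
    (V : Submodule ℝ (EuclideanSpace ℝ (Fin m))) (l : ℕ)
    (hV : V = ⊥ ∨ 2 * (finrank ℝ V + 2 * l) ≤ m) :
    ∫⁻ x, ((ENNReal.ofReal (‖Vᗮ.starProjection x‖ ^ 2 / ‖x‖ ^ 2)) ^ l)⁻¹ ∂μ ≤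
      ENNReal.ofReal (Real.exp (2 * l * finrank ℝ V / m)) := by
  have hae : ∀ {ρ : Measure (EuclideanSpace ℝ (Fin m))}, ρ {0} = 0 → ∀ᵐ y ∂ρ, y ≠ 0 := by
    intro ρ hρ
    rw [ae_iff]; simpa using hρ
  by_cases hbot : V = ⊥
  · subst hbot
    rw [lintegral_congr_ae (g := fun _ => 1)]
    · simp
    · filter_upwards [hae hμ0] with x hx
      have : ‖x‖ ≠ 0 := norm_ne_zero_iff.2 hx
      have htop : (⊤ : Submodule ℝ (EuclideanSpace ℝ (Fin m))).starProjection x = x :=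
        Submodule.starProjection_eq_self_iff.2 Submodule.mem_top
      simp [htop, this]
  have hV := hV.resolve_left hbot
  have hj : 0 < finrank ℝ V := Submodule.one_le_finrank_iff.2 hbot
  have hm : 0 < m := by omega
  have hnt : Nontrivial (EuclideanSpace ℝ (Fin m)) :=
    Module.nontrivial_of_finrank_pos (R := ℝ) (by simpa using hm)
  set j := finrank ℝ V with hjdef
  set G := stdGaussian (EuclideanSpace ℝ (Fin m)) with hG
  have hG0 : G {0} = 0 := stdGaussian_singleton_zero
  set A : ℝ := (2 ^ l)⁻¹ * Real.Gamma ((m : ℝ) / 2 - l) / Real.Gamma ((m : ℝ) / 2) with hA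
  have hVr : 2 * ((j : ℝ) + 2 * l) ≤ m := by exact_mod_cast hV
  have hjr : (0 : ℝ) < j := by exact_mod_cast hj
  have hlr : (0 : ℝ) ≤ l := Nat.cast_nonneg l
  have hApos : 0 < A := by
    have := Real.Gamma_pos_of_pos (show 0 < (m : ℝ) / 2 - l by linarith)
    have := Real.Gamma_pos_of_pos (show 0 < (m : ℝ) / 2 by linarith)
    positivity
  have hM : ∫⁻ x, ((ENNReal.ofReal (‖x‖ ^ 2)) ^ l)⁻¹ ∂G = ENNReal.ofReal A := by
    have := lintegral_stdGaussian_inv_normSq_pow (E := EuclideanSpace ℝ (Fin m)) l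
      (by simp; omega)
    simpa using this
  have hMV := lintegral_stdGaussian_inv_projection_pow V l (by omega)
  -- Tilting the Gaussian by `‖x‖⁻²ˡ` cancels the numerator of `(‖x‖² / ‖P x‖²)ˡ`, with `P` the
  -- projection onto `Vᗮ`. The mean becomes a quotient of two Gaussian negative moments, in
  -- dimensions `m - j` and `m`; no Beta law and no independence of norm and direction is needed.
  set w : ℝ → ENNReal := fun y => ((ENNReal.ofReal (y ^ 2)) ^ l)⁻¹ with hw
  have hwm : Measurable w := by fun_prop
  set ρ : Measure (EuclideanSpace ℝ (Fin m)) :=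
    (ENNReal.ofReal A)⁻¹ • G.withDensity fun x => w ‖x‖ with hρ
  have hρs : IsSphericallySymmetric ρ :=
    (isSphericallySymmetric_stdGaussian.withDensity_norm hwm).smul _
  have hAne : ENNReal.ofReal A ≠ 0 := by simpa using hApos
  have hρp : IsProbabilityMeasure ρ := by
    constructor
    rw [hρ, Measure.smul_apply, withDensity_apply _ MeasurableSet.univ, Measure.restrict_univ,
      hM, smul_eq_mul, ENNReal.inv_mul_cancel hAne ENNReal.ofReal_ne_top]
  have hρ0 : ρ {0} = 0 := by
    rw [hρ, Measure.smul_apply, withDensity_absolutelyContinuous _ _ hG0, smul_zero]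
  set K : EuclideanSpace ℝ (Fin m) → ENNReal :=
    fun x => ((ENNReal.ofReal (‖Vᗮ.starProjection x‖ ^ 2 / ‖x‖ ^ 2)) ^ l)⁻¹ with hK
  have hKm : Measurable K := by fun_prop
  have hKdir : ∀ x, x ≠ 0 → K (‖x‖⁻¹ • x) = K x := by
    intro x hx
    have : ‖x‖ ≠ 0 := norm_ne_zero_iff.2 hx
    simp only [hK, map_smul, norm_smul, norm_inv, norm_norm]
    congr 3
    field_simp
  have hchange : ∀ {σ : Measure (EuclideanSpace ℝ (Fin m))}, σ {0} = 0 →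
      ∫⁻ x, K x ∂σ = ∫⁻ x, K x ∂(σ.map fun x => ‖x‖⁻¹ • x) := by
    intro σ hσ
    rw [lintegral_map hKm measurable_normalize]
    refine lintegral_congr_ae ?_
    filter_upwards [hae hσ] with x hx
    exact (hKdir x hx).symm
  rw [hchange hμ0, hμ.map_direction_eq hρs hμ0 hρ0, ← hchange hρ0, hρ, lintegral_smul_measure,
    lintegral_withDensity_eq_lintegral_mul _ (by fun_prop) hKm]
  have hprod : ∫⁻ x, ((fun x : EuclideanSpace ℝ (Fin m) => w ‖x‖) * K) x ∂G =
      ∫⁻ x, ((ENNReal.ofReal (‖Vᗮ.starProjection x‖ ^ 2)) ^ l)⁻¹ ∂G := by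
    refine lintegral_congr_ae ?_
    filter_upwards [hae hG0] with x hx
    have hx : 0 < ‖x‖ := norm_pos_iff.2 hx
    have h1 : ENNReal.ofReal (‖x‖ ^ 2) ≠ 0 := by simp; positivity
    simp only [Pi.mul_apply, hw, hK]
    rw [← ENNReal.mul_inv (Or.inl (pow_ne_zero _ h1)) (Or.inl (by finiteness)), ← mul_pow,
      ← ENNReal.ofReal_mul (by positivity), mul_div_cancel₀ _ (by positivity)]
  rw [hprod, hMV, smul_eq_mul, mul_comm, ← div_eq_mul_inv, ← ENNReal.ofReal_div_of_pos hApos]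
  refine ENNReal.ofReal_le_ofReal ?_
  rw [div_le_iff₀ hApos]
  have := Gamma_shift_ratio_le (m := m) (n := (m : ℝ) - j) l (by linarith) (by linarith)
    (by linarith)
  simpa using this

end Spherical

/-! ### Integrating out one coordinate of a product -/

section ProductFubini

theorem lintegral_pi_eq_lintegral_update {ι : Type*} [Fintype ι] [DecidableEq ι] {X : ι → Type*}
    [∀ i, MeasurableSpace (X i)] (μ : ∀ i, Measure (X i)) [∀ i, IsProbabilityMeasure (μ i)]
    {f : (∀ i, X i) → ENNReal} (hf : Measurable f) (k : ι) :
    ∫⁻ x, f x ∂(Measure.pi μ) =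
      ∫⁻ x, ∫⁻ y, f (Function.update x k y) ∂(μ k) ∂(Measure.pi μ) := by
  have hg : Measurable fun x => ∫⁻ y, f (Function.update x k y) ∂(μ k) := by
    have := hf.lmarginal μ (s := {k})
    rwa [lmarginal_singleton] at this
  have hk : k ∉ Finset.univ.erase k := Finset.notMem_erase _ _
  have : ∀ i, Nonempty (X i) := fun i => (μ i).nonempty_of_neZero
  let x₀ : ∀ i, X i := fun i => Classical.arbitrary _
  rw [lintegral_eq_lmarginal_univ x₀, lintegral_eq_lmarginal_univ x₀,
    ← Finset.insert_erase (Finset.mem_univ k), lmarginal_insert' _ hf hk,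
    lmarginal_insert' _ hg hk]
  simp

end ProductFubini

/-! ### Linear combinations of independent spherical vectors -/

section SphericalCombinations

open ProbabilityTheory Module

variable {m : ℕ} {μ : Measure (EuclideanSpace ℝ (Fin m))}

theorem stdGaussian_span_singleton (hm : 2 ≤ m) (y : EuclideanSpace ℝ (Fin m)) :
    stdGaussian (EuclideanSpace ℝ (Fin m)) (Submodule.span ℝ {y} : Set _) = 0 := by
  obtain ⟨c, hc, hG⟩ := stdGaussian_eq_withDensity (E := EuclideanSpace ℝ (Fin m))
  rw [hG]
  refine withDensity_absolutelyContinuous _ _ (Measure.addHaar_submodule _ _ fun h => ?_)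
  have h1 := finrank_span_le_card (R := ℝ) ({y} : Set (EuclideanSpace ℝ (Fin m)))
  rw [h, finrank_top] at h1
  simp at h1
  omega

/-- All points with the direction of `y` lie on the line through `y`. The law of the direction is
the Gaussian one, and for `m ≥ 2` a line is Gaussian-null. -/
theorem IsSphericallySymmetric.measure_singleton [IsProbabilityMeasure μ]
    (hμ : IsSphericallySymmetric μ) (hμ0 : μ {0} = 0) (hm : 2 ≤ m)
    (y : EuclideanSpace ℝ (Fin m)) : μ {y} = 0 := by
  by_cases hy : y = 0
  · rwa [hy]
  have : Nontrivial (EuclideanSpace ℝ (Fin m)) := ⟨y, 0, hy⟩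
  set D : EuclideanSpace ℝ (Fin m) → EuclideanSpace ℝ (Fin m) := fun x => ‖x‖⁻¹ • x with hD
  have h1 : μ {y} ≤ μ (D ⁻¹' {D y}) := measure_mono (by rintro x rfl; rfl)
  have h2 : μ (D ⁻¹' {D y}) = stdGaussian (EuclideanSpace ℝ (Fin m)) (D ⁻¹' {D y}) := by
    rw [← Measure.map_apply measurable_normalize (measurableSet_singleton _),
      ← Measure.map_apply measurable_normalize (measurableSet_singleton _),
      hμ.map_direction_eq isSphericallySymmetric_stdGaussian hμ0 stdGaussian_singleton_zero]
  refine le_antisymm (h1.trans ?_) zero_le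
  rw [h2, ← stdGaussian_span_singleton hm y]
  refine measure_mono fun x hx => ?_
  have hx : ‖x‖⁻¹ • x = ‖y‖⁻¹ • y := hx
  have hy' : ‖y‖ ≠ 0 := norm_ne_zero_iff.2 hy
  by_cases hx0 : x = 0
  · rw [hx0]; exact Submodule.zero_mem _
  have hx' : ‖x‖ ≠ 0 := norm_ne_zero_iff.2 hx0
  refine Submodule.mem_span_singleton.2 ⟨‖x‖ * ‖y‖⁻¹, ?_⟩
  rw [mul_smul, ← hx, smul_smul, mul_inv_cancel₀ hx', one_smul]

/-- The law of `∑ a t • X t` for independent vectors `X t` with law `μ`. -/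
noncomputable def combinationLaw {ι : Type*} [Fintype ι] (μ : Measure (EuclideanSpace ℝ (Fin m)))
    (a : ι → ℝ) : Measure (EuclideanSpace ℝ (Fin m)) :=
  (Measure.pi fun _ : ι => μ).map fun X => ∑ t, a t • X t

variable {ι : Type*} [Fintype ι]

theorem measurable_combination (a : ι → ℝ) :
    Measurable fun X : ι → EuclideanSpace ℝ (Fin m) => ∑ t, a t • X t := by fun_prop

instance [IsProbabilityMeasure μ] (a : ι → ℝ) : IsProbabilityMeasure (combinationLaw μ a) :=
  Measure.isProbabilityMeasure_map (measurable_combination a).aemeasurable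

theorem IsSphericallySymmetric.combinationLaw [IsProbabilityMeasure μ]
    (hμ : IsSphericallySymmetric μ) (a : ι → ℝ) :
    IsSphericallySymmetric (combinationLaw μ a) := by
  intro O
  have hO : Measurable O := O.continuous.measurable
  have hpi : (Measure.pi fun _ : ι => μ).map (fun X t => O (X t)) = Measure.pi fun _ : ι => μ := by
    rw [Measure.pi_map_pi fun _ => hO.aemeasurable]
    simp only [hμ O]
  unfold _root_.combinationLaw
  rw [Measure.map_map hO (measurable_combination a)]
  conv_rhs => rw [← hpi]
  rw [Measure.map_map (measurable_combination a) (by fun_prop)]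
  congr 1
  funext X
  simp

/-- If `a k ≠ 0` and the other vectors are frozen, the sum vanishes for a single value of `X k`,
which is not an atom. -/
theorem IsSphericallySymmetric.combinationLaw_singleton_zero [IsProbabilityMeasure μ]
    (hμ : IsSphericallySymmetric μ) (hμ0 : μ {0} = 0) (hm : 2 ≤ m) {a : ι → ℝ} (ha : a ≠ 0) :
    _root_.combinationLaw μ a {0} = 0 := by
  classical
  obtain ⟨k, hk⟩ := Function.ne_iff.1 ha
  have hS : MeasurableSet ((fun X : ι → EuclideanSpace ℝ (Fin m) => ∑ t, a t • X t) ⁻¹' {0}) :=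
    measurable_combination a (measurableSet_singleton _)
  unfold _root_.combinationLaw
  rw [Measure.map_apply (measurable_combination a) (measurableSet_singleton _),
    ← lintegral_indicator_one hS, lintegral_pi_eq_lintegral_update _ (measurable_one.indicator hS) k,
    lintegral_eq_zero_of_ae_eq_zero]
  refine Filter.Eventually.of_forall fun X => ?_
  refine lintegral_eq_zero_of_ae_eq_zero ?_
  have hae : ∀ᵐ y ∂μ, y ≠ -(a k)⁻¹ • ∑ t ∈ Finset.univ.erase k, a t • X t := by
    rw [ae_iff]; simpa using hμ.measure_singleton hμ0 hm _
  filter_upwards [hae] with y hy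
  refine Set.indicator_of_notMem (fun h => hy ?_) _
  have h : ∑ t, a t • Function.update X k y t = 0 := h
  rw [← Finset.add_sum_erase _ _ (Finset.mem_univ k), Function.update_self,
    Finset.sum_congr rfl fun t ht => by
      rw [Function.update_of_ne (Finset.ne_of_mem_erase ht)]] at h
  rw [neg_smul, ← smul_neg, ← eq_neg_of_add_eq_zero_left h, smul_smul, inv_mul_cancel₀ hk, one_smul]

/-- Sums over disjoint blocks of independent vectors are independent. -/
theorem map_pi_blockCombination {κ : Type*} [Fintype κ] [IsProbabilityMeasure μ]
    (a : κ → ι → ℝ) :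
    (Measure.pi fun _ : ι × κ => μ).map (fun J k => ∑ t, a k t • J (t, k)) =
      Measure.pi fun k => combinationLaw μ (a k) := by
  have hsplit : (Measure.pi fun _ : ι × κ => μ).map (fun J k t => J (t, k)) =
      Measure.pi fun _ : κ => Measure.pi fun _ : ι => μ := by
    have hm : Measurable fun (J : ι × κ → EuclideanSpace ℝ (Fin m)) (k : κ) (t : ι) =>
      J (t, k) := by fun_prop
    have hm' : Measurable fun (Y : κ → ι → EuclideanSpace ℝ (Fin m)) (p : ι × κ) =>
      Y p.2 p.1 := by fun_prop
    have key : (Measure.pi fun _ : κ => Measure.pi fun _ : ι => μ).map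
        (fun Y (p : ι × κ) => Y p.2 p.1) = Measure.pi fun _ : ι × κ => μ := by
      symm
      refine Measure.pi_eq fun s hs => ?_
      rw [Measure.map_apply hm' (MeasurableSet.univ_pi hs)]
      have : (fun (Y : κ → ι → EuclideanSpace ℝ (Fin m)) (p : ι × κ) => Y p.2 p.1) ⁻¹'
          Set.univ.pi s = Set.univ.pi fun k => Set.univ.pi fun t => s (t, k) := by
        ext Y
        simp only [Set.mem_preimage, Set.mem_pi, Set.mem_univ, true_imp_iff, Prod.forall]
        exact ⟨fun h k t => h t k, fun h t k => h k t⟩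
      rw [this, Measure.pi_pi]
      simp only [Measure.pi_pi]
      rw [Fintype.prod_prod_type_right]
    rw [← key, Measure.map_map hm hm']
    exact Measure.map_id
  have hf : ∀ k, AEMeasurable (fun X : ι → EuclideanSpace ℝ (Fin m) => ∑ t, a k t • X t)
      (Measure.pi fun _ : ι => μ) := fun k => (measurable_combination _).aemeasurable
  have := Measure.pi_map_pi hf
  unfold combinationLaw
  rw [← this, ← hsplit, Measure.map_map (by fun_prop) (by fun_prop)]
  rfl

end SphericalCombinations

/-! ### The contrast through Gram–Schmidt -/

section GramSchmidt

open Module InnerProductSpace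

variable {F : Type*} [NormedAddCommGroup F] [InnerProductSpace ℝ F] {d : ℕ}

theorem linearIndependent_of_gramSchmidt_ne_zero {v : Fin d → F}
    (h : ∀ k, gramSchmidt ℝ v k ≠ 0) : LinearIndependent ℝ v := by
  have h1 : LinearIndependent ℝ (gramSchmidt ℝ v) :=
    linearIndependent_of_ne_zero_of_inner_eq_zero h fun i j hij => gramSchmidt_orthogonal ℝ v hij
  rw [linearIndependent_iff_card_eq_finrank_span] at h1 ⊢
  rw [h1, Set.finrank, Set.finrank, span_gramSchmidt]

/-- The matrix expressing `v` in its Gram–Schmidt vectors is unitriangular, hence of determinant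
one. Independence is not needed: division by a zero norm yields coefficient `0`, which is harmless
on a zero vector. -/
theorem det_gram_eq_prod_gramSchmidt (v : Fin d → F) :
    (Matrix.gram ℝ v).det = ∏ k, ‖gramSchmidt ℝ v k‖ ^ 2 := by
  set U : Matrix (Fin d) (Fin d) ℝ := Matrix.of fun i k =>
    if i = k then 1 else if i < k then
      inner ℝ (gramSchmidt ℝ v i) (v k) / ‖gramSchmidt ℝ v i‖ ^ 2 else 0 with hU
  have hv : ∀ k, v k = ∑ i, U i k • gramSchmidt ℝ v i := by
    intro k
    have h1 : ∑ i, U i k • gramSchmidt ℝ v i = gramSchmidt ℝ v k + ∑ i ∈ Finset.Iio k,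
        (inner ℝ (gramSchmidt ℝ v i) (v k) / ‖gramSchmidt ℝ v i‖ ^ 2) • gramSchmidt ℝ v i := by
      rw [← Finset.add_sum_erase _ _ (Finset.mem_univ k)]
      congr 1
      · simp [hU]
      · refine (Finset.sum_subset_zero_on_sdiff ?_ ?_ ?_).symm
        · intro i hi
          exact Finset.mem_erase.2 ⟨(Finset.mem_Iio.1 hi).ne, Finset.mem_univ _⟩
        · intro i hi
          rw [Finset.mem_sdiff, Finset.mem_erase, Finset.mem_Iio] at hi
          simp [hU, hi.1.1, hi.2]
        · intro i hi
          have hi := Finset.mem_Iio.1 hi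
          simp [hU, hi, hi.ne]
    rw [h1]
    exact gramSchmidt_def'' ℝ v k
  have hG : Matrix.gram ℝ v =
      U.transpose * Matrix.diagonal (fun i => ‖gramSchmidt ℝ v i‖ ^ 2) * U := by
    ext j k
    rw [Matrix.gram_apply, Matrix.mul_apply]
    simp only [Matrix.mul_diagonal, Matrix.transpose_apply]
    conv_lhs => rw [hv j, hv k, sum_inner]
    refine Finset.sum_congr rfl fun i _ => ?_
    rw [inner_sum, Finset.sum_eq_single i]
    · rw [inner_smul_left, inner_smul_right, real_inner_self_eq_norm_sq]
      simp only [conj_trivial]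
      ring
    · intro b _ hb
      rw [inner_smul_left, inner_smul_right, gramSchmidt_orthogonal ℝ v hb.symm]
      simp
    · simp
  have hdet : U.det = 1 := by
    rw [Matrix.det_of_isUpperTriangular]
    · simp [hU]
    · intro i j hij
      have hij : j < i := hij
      simp [hU, hij.ne', hij.not_gt]
  rw [hG, Matrix.det_mul, Matrix.det_mul, Matrix.det_transpose, hdet, Matrix.det_diagonal]
  simp

/-- The `IMA` contrast of a family of columns. -/
noncomputable def columnContrast (v : Fin d → F) : ℝ :=
  ∑ k, Real.log ‖v k‖ - (1 / 2) * Real.log (Matrix.gram ℝ v).det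

/-- The exponential of `2 * l` times the contrast, with value `∞` at dependent columns. -/
noncomputable def contrastWeight (l : ℕ) (v : Fin d → F) : ENNReal :=
  ∏ k, ((ENNReal.ofReal (‖gramSchmidt ℝ v k‖ ^ 2 / ‖v k‖ ^ 2)) ^ l)⁻¹

/-- A zero Gram–Schmidt vector makes its factor infinite (also when `v k = 0`, since `0 / 0 = 0`),
and no other factor vanishes to compensate. Finite moments thus yield full rank almost surely. -/
theorem gramSchmidt_ne_zero_of_contrastWeight_ne_top {l : ℕ} (hl : l ≠ 0) {v : Fin d → F}
    (h : contrastWeight l v ≠ ⊤) (k : Fin d) : gramSchmidt ℝ v k ≠ 0 := by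
  intro hk
  refine h (WithTop.prod_eq_top_iff.2 ⟨⟨k, Finset.mem_univ k, ?_⟩, fun i _ => ?_⟩)
  · change _ = (⊤ : ENNReal)
    simp [hk, hl]
  · exact ENNReal.inv_ne_zero.2 (by finiteness)

variable [FiniteDimensional ℝ F]

theorem gramSchmidt_eq_starProjection (v : Fin d → F) (k : Fin d) :
    gramSchmidt ℝ v k = (Submodule.span ℝ (v '' Set.Iio k))ᗮ.starProjection (v k) := by
  symm
  rw [← span_gramSchmidt_Iio ℝ v k]
  refine Submodule.eq_starProjection_of_mem_orthogonal ?_ ?_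
  · rw [Submodule.mem_orthogonal]
    intro u hu
    induction hu using Submodule.span_induction with
    | mem x hx =>
      obtain ⟨i, hi, rfl⟩ := hx
      exact gramSchmidt_orthogonal ℝ v (ne_of_lt hi)
    | zero => simp
    | add x y _ _ hx hy => rw [inner_add_left, hx, hy, add_zero]
    | smul c x _ hx => rw [inner_smul_left, hx, mul_zero]
  · refine Submodule.le_orthogonal_orthogonal _ ?_
    rw [gramSchmidt_def, sub_sub_cancel]
    refine Submodule.sum_mem _ fun i hi => ?_
    rw [Submodule.starProjection_singleton]
    exact Submodule.smul_mem _ _ (Submodule.subset_span ⟨i, Finset.mem_Iio.1 hi, rfl⟩)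

theorem norm_gramSchmidt_le (v : Fin d → F) (k : Fin d) : ‖gramSchmidt ℝ v k‖ ≤ ‖v k‖ := by
  rw [gramSchmidt_eq_starProjection]
  exact Submodule.norm_starProjection_apply_le _ _

theorem columnContrast_eq {v : Fin d → F} (h : ∀ k, gramSchmidt ℝ v k ≠ 0) :
    columnContrast v = ∑ k, Real.log (‖v k‖ / ‖gramSchmidt ℝ v k‖) := by
  unfold columnContrast
  have hv : ∀ k, ‖v k‖ ≠ 0 := fun k hk =>
    h k (norm_le_zero_iff.1 (hk ▸ norm_gramSchmidt_le v k))
  rw [det_gram_eq_prod_gramSchmidt v, Real.log_prod fun k _ => by simpa using h k,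
    Finset.mul_sum, ← Finset.sum_sub_distrib]
  refine Finset.sum_congr rfl fun k _ => ?_
  rw [Real.log_div (hv k) (norm_ne_zero_iff.2 (h k)), Real.log_pow]
  push_cast
  ring

theorem columnContrast_nonneg {v : Fin d → F} (h : ∀ k, gramSchmidt ℝ v k ≠ 0) :
    0 ≤ columnContrast v := by
  rw [columnContrast_eq h]
  refine Finset.sum_nonneg fun k _ => Real.log_nonneg ?_
  rw [one_le_div (norm_pos_iff.2 (h k))]
  exact norm_gramSchmidt_le v k

theorem ofReal_exp_columnContrast (l : ℕ) {v : Fin d → F} (h : ∀ k, gramSchmidt ℝ v k ≠ 0) :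
    ENNReal.ofReal (Real.exp (2 * l * columnContrast v)) = contrastWeight l v := by
  rw [columnContrast_eq h, Finset.mul_sum, Real.exp_sum,
    ENNReal.ofReal_prod_of_nonneg fun _ _ => (Real.exp_pos _).le]
  unfold contrastWeight
  refine Finset.prod_congr rfl fun k _ => ?_
  have hg : 0 < ‖gramSchmidt ℝ v k‖ := norm_pos_iff.2 (h k)
  have hv : 0 < ‖v k‖ := hg.trans_le (norm_gramSchmidt_le v k)
  rw [← ENNReal.ofReal_pow (by positivity), ← ENNReal.ofReal_inv_of_pos (by positivity)]
  congr 1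
  have : 2 * (l : ℝ) * Real.log (‖v k‖ / ‖gramSchmidt ℝ v k‖) =
      ((2 * l : ℕ) : ℝ) * Real.log (‖v k‖ / ‖gramSchmidt ℝ v k‖) := by push_cast; ring
  rw [this, Real.exp_nat_mul, Real.exp_log (by positivity), pow_mul, ← inv_pow, div_pow, inv_div]

variable [MeasurableSpace F] [BorelSpace F]

theorem measurable_gramSchmidt (k : Fin d) :
    Measurable fun v : Fin d → F => gramSchmidt ℝ v k := by
  induction k using WellFoundedLT.induction with
  | _ k ih =>
    have h : (fun v : Fin d → F => gramSchmidt ℝ v k) = fun v => v k - ∑ i ∈ Finset.Iio k,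
        (inner ℝ (gramSchmidt ℝ v i) (v k) / ‖gramSchmidt ℝ v i‖ ^ 2) • gramSchmidt ℝ v i := by
      funext v
      exact eq_sub_of_add_eq (gramSchmidt_def'' ℝ v k).symm
    rw [h]
    refine (measurable_pi_apply k).sub (Finset.measurable_fun_sum _ fun i hi => ?_)
    have hi := ih i (Finset.mem_Iio.1 hi)
    fun_prop

theorem measurable_gramSchmidt_factor (l : ℕ) (k : Fin d) : Measurable fun v : Fin d → F =>
    ((ENNReal.ofReal (‖gramSchmidt ℝ v k‖ ^ 2 / ‖v k‖ ^ 2)) ^ l)⁻¹ := by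
  have := measurable_gramSchmidt (F := F) k
  fun_prop

theorem measurable_contrastWeight (l : ℕ) :
    Measurable fun v : Fin d → F => contrastWeight l v :=
  Finset.measurable_fun_prod _ fun k _ => measurable_gramSchmidt_factor l k

theorem measurable_columnContrast : Measurable fun v : Fin d → F => columnContrast v := by
  unfold columnContrast
  simp_rw [det_gram_eq_prod_gramSchmidt]
  have := measurable_gramSchmidt (F := F) (d := d)
  fun_prop

end GramSchmidt

/-! ### Exponential moments of the contrast -/

section ContrastMoment

open Module InnerProductSpace

variable {d m : ℕ}

theorem span_image_update_Iio {F : Type*} [AddCommGroup F] [Module ℝ F] (v : Fin d → F)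
    {i k : Fin d} (hik : i ≤ k) (y : F) :
    Submodule.span ℝ (Function.update v k y '' Set.Iio i) = Submodule.span ℝ (v '' Set.Iio i) := by
  congr 1
  refine Set.image_congr fun a ha => ?_
  exact Function.update_of_ne (ne_of_lt (lt_of_lt_of_le ha hik)) _ _

/-- Exponential moments of the contrast of independent spherically symmetric columns. -/
theorem lintegral_contrastWeight_le (ν : Fin d → Measure (EuclideanSpace ℝ (Fin m)))
    [∀ k, IsProbabilityMeasure (ν k)] (hν : ∀ k, IsSphericallySymmetric (ν k))
    (hν0 : ∀ k, ν k {0} = 0) (l : ℕ) (hl : ∀ k < d, k = 0 ∨ 2 * (k + 2 * l) ≤ m) :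
    ∫⁻ v, contrastWeight l v ∂(Measure.pi ν) ≤
      ENNReal.ofReal (Real.exp (∑ k ∈ Finset.range d, 2 * (l : ℝ) * k / m)) := by
  set φ : Fin d → (Fin d → EuclideanSpace ℝ (Fin m)) → ENNReal := fun k v =>
    ((ENNReal.ofReal (‖gramSchmidt ℝ v k‖ ^ 2 / ‖v k‖ ^ 2)) ^ l)⁻¹ with hφ
  have hφm : ∀ k, Measurable (φ k) := fun k => measurable_gramSchmidt_factor l k
  have hlt : ∀ (k i : Fin d) (v) (y), i < k → φ i (Function.update v k y) = φ i v := by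
    intro k i v y hik
    simp only [hφ, gramSchmidt_eq_starProjection]
    rw [span_image_update_Iio v hik.le, Function.update_of_ne hik.ne]
  have hself : ∀ (k : Fin d) (v), ∫⁻ y, φ k (Function.update v k y) ∂(ν k) ≤
      ENNReal.ofReal (Real.exp (2 * (l : ℝ) * k / m)) := by
    intro k v
    simp only [hφ, gramSchmidt_eq_starProjection]
    simp_rw [span_image_update_Iio v le_rfl, Function.update_self]
    have hcard : finrank ℝ (Submodule.span ℝ (v '' Set.Iio k)) ≤ k := by
      classical
      have h := finrank_span_finset_le_card (R := ℝ) ((Finset.Iio k).image v)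
      rw [Finset.coe_image, Finset.coe_Iio] at h
      refine h.trans (Finset.card_image_le.trans ?_)
      simp
    refine ((hν k).lintegral_inv_ratio_pow_le (hν0 k) _ l ?_).trans ?_
    · rcases hl k k.2 with h | h
      · left
        exact Submodule.finrank_eq_zero.1 (by omega)
      · right
        omega
    · refine ENNReal.ofReal_le_ofReal (Real.exp_le_exp.2 ?_)
      gcongr
  -- Factors of index below `n` do not involve column `n`. Integrating that column first therefore
  -- costs a constant and leaves the product of the earlier factors.
  have key : ∀ n ≤ d, ∫⁻ v, ∏ k with k.val < n, φ k v ∂(Measure.pi ν) ≤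
      ENNReal.ofReal (Real.exp (∑ k ∈ Finset.range n, 2 * (l : ℝ) * k / m)) := by
    intro n
    induction n with
    | zero => intro _; simp
    | succ n ih =>
      intro hn
      have ih := ih (by omega)
      set k : Fin d := ⟨n, hn⟩ with hk
      have hfil : Finset.univ.filter (fun i : Fin d => i.val < n + 1) =
          insert k (Finset.univ.filter fun i : Fin d => i.val < n) := by
        ext i
        simp [hk, Fin.ext_iff]
        omega
      have hnot : k ∉ Finset.univ.filter fun i : Fin d => i.val < n := by simp [hk]
      have hmeas : Measurable fun v => ∏ i with i.val < n, φ i v :=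
        Finset.measurable_fun_prod _ fun i _ => hφm i
      simp_rw [hfil, Finset.prod_insert hnot]
      have hprod : Measurable fun v => φ k v * ∏ i with i.val < n, φ i v := (hφm k).mul hmeas
      rw [lintegral_pi_eq_lintegral_update ν hprod k]
      have hin : ∀ v, ∫⁻ y, φ k (Function.update v k y) *
          ∏ i with i.val < n, φ i (Function.update v k y) ∂(ν k) ≤
          ENNReal.ofReal (Real.exp (2 * (l : ℝ) * n / m)) * ∏ i with i.val < n, φ i v := by
        intro v
        have h1 : ∀ y, ∏ i with i.val < n, φ i (Function.update v k y) =
            ∏ i with i.val < n, φ i v := fun y =>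
          Finset.prod_congr rfl fun i hi => hlt k i v y (by
            simpa [hk, Fin.lt_def] using hi)
        simp_rw [h1]
        have hcomp : Measurable fun y => φ k (Function.update v k y) :=
          (hφm k).comp (measurable_update v)
        rw [lintegral_mul_const _ hcomp]
        gcongr
        exact hself k v
      refine (lintegral_mono hin).trans ?_
      rw [lintegral_const_mul _ hmeas, Finset.sum_range_succ, add_comm, Real.exp_add,
        ENNReal.ofReal_mul (Real.exp_pos _).le]
      gcongr
  have := key d le_rfl
  simpa [contrastWeight, hφ] using this

end ContrastMoment

/-! ### Jacobian of the smoothed grid-wise affine map -/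

section GridDerivative

/-- The derivative of `smoothStep ε` away from `±ε`. -/
noncomputable def smoothStepDeriv (ε u : ℝ) : ℝ :=
  if |u| < ε then (1 / 2) * (Real.cos (Real.pi * u / (2 * ε)) * (Real.pi / (2 * ε))) else 0

theorem hasDerivAt_smoothStep {ε u : ℝ} (hε : 0 < ε) (hu : |u| ≠ ε) :
    HasDerivAt (smoothStep ε) (smoothStepDeriv ε u) u := by
  rcases lt_or_gt_of_ne hu with h | h
  · have h' := abs_lt.1 h
    rw [smoothStepDeriv, if_pos h]
    have hev : smoothStep ε =ᶠ[nhds u]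
        fun s => (1 / 2) * Real.sin (Real.pi * s / (2 * ε)) + 1 / 2 := by
      filter_upwards [Ioo_mem_nhds h'.1 h'.2] with s hs
      rw [smoothStep, if_neg (not_le.2 hs.1), if_pos hs.2.le]
    refine HasDerivAt.congr_of_eventuallyEq ?_ hev
    have h1 : HasDerivAt (fun s : ℝ => Real.pi * s / (2 * ε)) (Real.pi / (2 * ε)) u := by
      simpa using ((hasDerivAt_id u).const_mul Real.pi).div_const (2 * ε)
    exact (h1.sin.const_mul (1 / 2)).add_const (1 / 2)
  · rw [smoothStepDeriv, if_neg h.not_gt]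
    rcases lt_abs.1 h with h | h
    · refine (hasDerivAt_const u (1 : ℝ)).congr_of_eventuallyEq ?_
      filter_upwards [Ioi_mem_nhds h] with s hs
      have hs : ε < s := hs
      rw [smoothStep, if_neg (by linarith), if_neg (by linarith)]
    · refine (hasDerivAt_const u (0 : ℝ)).congr_of_eventuallyEq ?_
      filter_upwards [Iio_mem_nhds (show u < -ε by linarith)] with s hs
      have hs : s < -ε := hs
      rw [smoothStep, if_pos hs.le]

theorem smoothStepDeriv_nonneg {ε : ℝ} (hε : 0 < ε) (u : ℝ) : 0 ≤ smoothStepDeriv ε u := by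
  unfold smoothStepDeriv
  split_ifs with h
  · have h' := abs_lt.1 h
    have : 0 ≤ Real.cos (Real.pi * u / (2 * ε)) := by
      refine Real.cos_nonneg_of_neg_pi_div_two_le_of_le ?_ ?_
      · rw [le_div_iff₀ (by positivity)]
        nlinarith [Real.pi_pos]
      · rw [div_le_iff₀ (by positivity)]
        nlinarith [Real.pi_pos]
    positivity
  · exact le_rfl

theorem half_le_smoothStep {ε s : ℝ} (hε : 0 < ε) (hs : 0 ≤ s) : 1 / 2 ≤ smoothStep ε s := by
  rw [smoothStep, if_neg (by linarith)]
  split_ifs with h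
  · have : 0 ≤ Real.sin (Real.pi * s / (2 * ε)) := by
      refine Real.sin_nonneg_of_nonneg_of_le_pi (by positivity) ?_
      rw [div_le_iff₀ (by positivity)]
      nlinarith [Real.pi_pos]
    linarith
  · norm_num

theorem measurable_smoothStep (ε : ℝ) : Measurable (smoothStep ε) := by
  unfold smoothStep
  refine Measurable.ite measurableSet_Iic (by fun_prop) ?_
  exact Measurable.ite measurableSet_Iic (by fun_prop) (by fun_prop)

theorem measurable_smoothStepDeriv (ε : ℝ) : Measurable (smoothStepDeriv ε) := by
  unfold smoothStepDeriv
  exact Measurable.ite (measurableSet_lt (by fun_prop) (by fun_prop)) (by fun_prop) (by fun_prop)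

/-- The smooth indicator of the part number `t` of the grid. -/
noncomputable def gridBump (w ε : ℝ) (t : ℕ) (x : ℝ) : ℝ :=
  smoothStep ε (x - (t : ℝ) * w) - smoothStep ε (x - ((t : ℝ) + 1) * w)

/-- The derivative of `gridBump`. -/
noncomputable def gridBumpDeriv (w ε : ℝ) (t : ℕ) (x : ℝ) : ℝ :=
  smoothStepDeriv ε (x - (t : ℝ) * w) - smoothStepDeriv ε (x - ((t : ℝ) + 1) * w)

/-- The coefficient of the column number `t` in the derivative of `smoothGridCoord`. -/
noncomputable def gridCoeff (w ε : ℝ) (x : ℝ) (t : Fin (gridParts w)) : ℝ :=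
  gridBump w ε t x + gridBumpDeriv w ε t x * (x - (t : ℝ) * w) +
    ∑ i ∈ Finset.Ioi t, gridBumpDeriv w ε i x * w

theorem measurable_gridCoeff (w ε : ℝ) (t : Fin (gridParts w)) :
    Measurable fun x => gridCoeff w ε x t := by
  unfold gridCoeff gridBump gridBumpDeriv
  have := measurable_smoothStep ε
  have := measurable_smoothStepDeriv ε
  fun_prop

theorem hasDerivAt_gridBump {w ε x : ℝ} (hε : 0 < ε) (hx : ∀ n : ℕ, |x - n * w| ≠ ε) (t : ℕ) :
    HasDerivAt (gridBump w ε t) (gridBumpDeriv w ε t x) x := by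
  have h1 := (hasDerivAt_smoothStep hε (hx t)).comp_sub_const x ((t : ℝ) * w)
  have h2 := (hasDerivAt_smoothStep (u := x - ((t : ℝ) + 1) * w) hε
    (by simpa using hx (t + 1))).comp_sub_const x (((t : ℝ) + 1) * w)
  exact h1.sub h2

variable {d m : ℕ} {w ε : ℝ}

theorem hasDerivAt_smoothGridCoord (hε : 0 < ε) (J : GridColumns d m w) (k : Fin d) {x : ℝ}
    (hx : ∀ n : ℕ, |x - n * w| ≠ ε) :
    HasDerivAt (smoothGridCoord ε J k) (∑ t, gridCoeff w ε x t • J (t, k)) x := by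
  have hterm : ∀ t : Fin (gridParts w), HasDerivAt (fun x : ℝ => gridBump w ε t x •
      ((x - (t : ℝ) * w) • J (t, k) + ∑ i ∈ Finset.Iio t, w • J (i, k)))
      (gridBump w ε t x • J (t, k) + gridBumpDeriv w ε t x •
        ((x - (t : ℝ) * w) • J (t, k) + ∑ i ∈ Finset.Iio t, w • J (i, k))) x := by
    intro t
    refine (hasDerivAt_gridBump hε hx t).smul ?_
    have h := (((hasDerivAt_id x).sub_const ((t : ℝ) * w)).smul_const (J (t, k))).add_const
      (∑ i ∈ Finset.Iio t, w • J (i, k))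
    simpa using h
  have hsum := HasDerivAt.fun_sum (u := Finset.univ) fun t _ => hterm t
  suffices heq : ∑ t, gridCoeff w ε x t • J (t, k) = ∑ t : Fin (gridParts w),
      (gridBump w ε t x • J (t, k) + gridBumpDeriv w ε t x •
        ((x - (t : ℝ) * w) • J (t, k) + ∑ i ∈ Finset.Iio t, w • J (i, k))) by
    rw [heq]
    exact hsum
  simp only [gridCoeff, add_smul, smul_add, Finset.sum_add_distrib, smul_smul, Finset.sum_smul,
    Finset.smul_sum]
  rw [add_assoc]
  congr 2
  -- Collecting the coefficient of `J (t, k)`: it occurs in the offsets of all later parts, so the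
  -- sum over `i < t` turns into one over `i > t`.
  refine Finset.sum_comm' fun a b => ?_
  simp

theorem jacobianCol_smoothGridMap (hε : 0 < ε) (J : GridColumns d m w) {s : Fin d → ℝ}
    (hs : ∀ k, ∀ n : ℕ, |s k - n * w| ≠ ε) (k : Fin d) :
    jacobianCol (smoothGridMap ε J) s k = ∑ t, gridCoeff w ε (s k) t • J (t, k) := by
  have h : HasFDerivAt (smoothGridMap ε J) (∑ j : Fin d,
      (ContinuousLinearMap.toSpanSingleton ℝ (∑ t, gridCoeff w ε (s j) t • J (t, j))).comp
        (ContinuousLinearMap.proj (R := ℝ) (φ := fun _ : Fin d => ℝ) j)) s := by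
    refine HasFDerivAt.fun_sum fun j _ => ?_
    exact (hasDerivAt_smoothGridCoord hε J j (hs j)).hasFDerivAt.comp s
      (ContinuousLinearMap.proj (R := ℝ) (φ := fun _ : Fin d => ℝ) j).hasFDerivAt
  rw [jacobianCol, h.fderiv, sum_apply, Finset.sum_eq_single k]
  · simp
  · intro j _ hj
    simp [hj]
  · simp

theorem one_add_le_gridParts_mul (hw : 0 < w) : 1 + w ≤ (gridParts w : ℝ) * w := by
  have h := Nat.le_ceil (1 / w)
  rw [div_le_iff₀ hw] at h
  unfold gridParts
  push_cast
  linarith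

/-- The offsets combine as `(x - t w) + t w = x`, so both sums telescope. The end terms at `x - p w`
vanish because `p w ≥ 1 + w > x + ε`; this uses the extra part in `gridParts`. -/
theorem sum_gridCoeff (x : ℝ) (hε : 0 < ε) (hεw : ε < w) (hx : x ≤ 1) :
    ∑ t, gridCoeff w ε x t = smoothStep ε x + x * smoothStepDeriv ε x := by
  have hp := one_add_le_gridParts_mul (hε.trans hεw)
  have tel : ∀ f : ℝ → ℝ, ∑ t : Fin (gridParts w), (f (x - (t : ℝ) * w) -
      f (x - ((t : ℝ) + 1) * w)) = f x - f (x - gridParts w * w) := by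
    intro f
    rw [Fin.sum_univ_eq_sum_range fun t : ℕ => f (x - (t : ℝ) * w) - f (x - ((t : ℝ) + 1) * w)]
    have := Finset.sum_range_sub' (fun t : ℕ => f (x - (t : ℝ) * w)) (gridParts w)
    push_cast at this
    simpa using this
  have hlast : smoothStep ε (x - gridParts w * w) = 0 := by
    rw [smoothStep, if_pos (by linarith)]
  have hlast' : smoothStepDeriv ε (x - gridParts w * w) = 0 := by
    rw [smoothStepDeriv, if_neg]
    rw [not_lt, le_abs]
    right
    linarith
  have h1 : ∑ t : Fin (gridParts w), ∑ i ∈ Finset.Ioi t, gridBumpDeriv w ε i x * w =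
      ∑ i : Fin (gridParts w), gridBumpDeriv w ε i x * ((i : ℝ) * w) := by
    rw [Finset.sum_comm' (t' := Finset.univ) (s' := fun i => Finset.Iio i) (by simp)]
    refine Finset.sum_congr rfl fun i _ => ?_
    rw [Finset.sum_const, Fin.card_Iio, nsmul_eq_mul]
    ring
  have h2 := tel (smoothStep ε)
  have h3 := tel (smoothStepDeriv ε)
  rw [hlast, sub_zero] at h2
  rw [hlast', sub_zero] at h3
  simp only [gridCoeff, Finset.sum_add_distrib]
  rw [add_assoc, h1, ← Finset.sum_add_distrib]
  rw [← h2, ← h3, Finset.mul_sum]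
  congr 1
  refine Finset.sum_congr rfl fun i _ => ?_
  unfold gridBumpDeriv
  ring

theorem gridCoeff_ne_zero {x : ℝ} (hε : 0 < ε) (hεw : ε < w) (hx0 : 0 ≤ x) (hx : x ≤ 1) :
    gridCoeff w ε x ≠ 0 := by
  intro h
  have h1 := sum_gridCoeff x hε hεw hx
  have h2 := half_le_smoothStep hε hx0
  have h3 := mul_nonneg hx0 (smoothStepDeriv_nonneg hε x)
  simp only [h, Pi.zero_apply, Finset.sum_const_zero] at h1
  linarith

/-- Almost every point has no coordinate at the ends of the smoothing intervals. -/
theorem ae_abs_sub_ne (w ε : ℝ) :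
    ∀ᵐ s : Fin d → ℝ, ∀ k, ∀ n : ℕ, |s k - n * w| ≠ ε := by
  rw [ae_all_iff]
  intro k
  rw [ae_all_iff]
  intro n
  have hne : ∀ a : ℝ, ∀ᵐ s : Fin d → ℝ, s k ≠ a := by
    intro a
    have h : volume {s : Fin d → ℝ | s k = a} = 0 :=
      Measure.pi_hyperplane (fun _ : Fin d => (volume : Measure ℝ)) k a
    rw [ae_iff]
    simpa using h
  filter_upwards [hne (n * w + ε), hne (n * w - ε)] with s h1 h2 h
  rcases eq_or_eq_neg_of_abs_eq h with h | h
  · exact h1 (by linarith)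
  · exact h2 (by linarith)

theorem localIMA_eq_columnContrast (f : (Fin d → ℝ) → EuclideanSpace ℝ (Fin m)) (s : Fin d → ℝ) :
    localIMA f s = columnContrast (jacobianCol f s) := by
  have : (jacobian f s).transpose * jacobian f s = Matrix.gram ℝ (jacobianCol f s) := by
    ext j k
    simp [Matrix.mul_apply, jacobian, Matrix.gram_apply, PiLp.inner_apply, mul_comm]
  rw [localIMA, this, columnContrast]

end GridDerivative

/-! ### From moments to the tail of the global contrast -/

section GridContrast

open InnerProductSpace

variable {d m : ℕ} {w ε : ℝ}

/-- The columns of the Jacobian of the smoothed grid-wise affine map. -/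
noncomputable def gridJacobian (ε : ℝ) (J : GridColumns d m w) (s : Fin d → ℝ) (k : Fin d) :
    EuclideanSpace ℝ (Fin m) :=
  ∑ t, gridCoeff w ε (s k) t • J (t, k)

theorem measurable_gridJacobian :
    Measurable fun p : GridColumns d m w × (Fin d → ℝ) => gridJacobian ε p.1 p.2 := by
  refine measurable_pi_lambda _ fun k => ?_
  unfold gridJacobian
  refine Finset.measurable_fun_sum _ fun t _ => ?_
  have h : Measurable fun p : GridColumns d m w × (Fin d → ℝ) => gridCoeff w ε (p.2 k) t :=
    (measurable_gridCoeff w ε t).comp ((measurable_pi_apply k).comp measurable_snd)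
  fun_prop

theorem measurable_gridJacobian_right (J : GridColumns d m w) :
    Measurable fun s : Fin d → ℝ => gridJacobian ε J s := by
  refine measurable_pi_lambda _ fun k => Finset.measurable_fun_sum _ fun t _ => ?_
  have h : Measurable fun s : Fin d → ℝ => gridCoeff w ε (s k) t :=
    (measurable_gridCoeff w ε t).comp (measurable_pi_apply k)
  exact h.smul_const _

theorem measurable_contrastWeight_gridJacobian (l : ℕ) :
    Measurable fun p : GridColumns d m w × (Fin d → ℝ) =>
      contrastWeight l (gridJacobian ε p.1 p.2) :=
  (measurable_contrastWeight l).comp measurable_gridJacobian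

instance (w : ℝ) (pr : Measure (EuclideanSpace ℝ (Fin m))) [IsProbabilityMeasure pr] :
    IsProbabilityMeasure (gridLaw d w pr) := by
  unfold gridLaw
  infer_instance

variable {pr : Measure (EuclideanSpace ℝ (Fin m))} [IsProbabilityMeasure pr]

theorem lintegral_gridLaw_contrastWeight_le (hpr : IsSphericallySymmetric pr) (hpr0 : pr {0} = 0)
    (hm : 2 ≤ m) (hε : 0 < ε) (hεw : ε < w) {l : ℕ}
    (hl : ∀ k < d, k = 0 ∨ 2 * (k + 2 * l) ≤ m) {s : Fin d → ℝ} (hs : s ∈ unitCube d) :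
    ∫⁻ J, contrastWeight l (gridJacobian ε J s) ∂(gridLaw d w pr) ≤
      ENNReal.ofReal (Real.exp (∑ k ∈ Finset.range d, 2 * (l : ℝ) * k / m)) := by
  have hmap := map_pi_blockCombination (μ := pr) fun k : Fin d => gridCoeff w ε (s k)
  have hmeas : Measurable fun (J : GridColumns d m w) (k : Fin d) =>
      ∑ t, gridCoeff w ε (s k) t • J (t, k) := by fun_prop
  have h := lintegral_map (μ := gridLaw d w pr) (measurable_contrastWeight l) hmeas
  refine (Eq.le h.symm).trans ?_
  unfold gridLaw
  rw [hmap]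
  refine lintegral_contrastWeight_le _ (fun k => hpr.combinationLaw _) (fun k => ?_) l hl
  exact hpr.combinationLaw_singleton_zero hpr0 hm (gridCoeff_ne_zero hε hεw (hs.1 k) (hs.2 k))

theorem lintegral_lintegral_contrastWeight_le (hpr : IsSphericallySymmetric pr)
    (hpr0 : pr {0} = 0) (hm : 2 ≤ m) (hε : 0 < ε) (hεw : ε < w) {l : ℕ}
    (hl : ∀ k < d, k = 0 ∨ 2 * (k + 2 * l) ≤ m) (Q : Measure (Fin d → ℝ)) [SFinite Q]
    (hQ : ∀ᵐ s ∂Q, s ∈ unitCube d) :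
    ∫⁻ J, ∫⁻ s, contrastWeight l (gridJacobian ε J s) ∂Q ∂(gridLaw d w pr) ≤
      ENNReal.ofReal (Real.exp (∑ k ∈ Finset.range d, 2 * (l : ℝ) * k / m)) * Q Set.univ := by
  rw [lintegral_lintegral_swap (measurable_contrastWeight_gridJacobian l).aemeasurable,
    ← lintegral_const]
  refine lintegral_mono_ae ?_
  filter_upwards [hQ] with s hs
  exact lintegral_gridLaw_contrastWeight_le hpr hpr0 hm hε hεw hl hs

theorem ae_jacobianCol_eq (hε : 0 < ε) (J : GridColumns d m w) :
    ∀ᵐ s ∂(volume.restrict (unitCube d)),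
      jacobianCol (smoothGridMap ε J) s = gridJacobian ε J s := by
  refine ae_restrict_of_ae ?_
  filter_upwards [ae_abs_sub_ne w ε] with s hs
  funext k
  exact jacobianCol_smoothGridMap hε J hs k

/-- The probability measure on the cube with a given density. -/
noncomputable def cubeMeasure (ps : (Fin d → ℝ) → ℝ) : Measure (Fin d → ℝ) :=
  (volume.restrict (unitCube d)).withDensity fun s => ENNReal.ofReal (ps s)

theorem measurableSet_unitCube : MeasurableSet (unitCube d) := measurableSet_Icc

theorem ae_mem_unitCube : ∀ᵐ s ∂(volume.restrict (unitCube d)), s ∈ unitCube d :=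
  ae_restrict_mem measurableSet_unitCube

theorem IsDensityOnCube.isProbabilityMeasure {ps : (Fin d → ℝ) → ℝ} (hps : IsDensityOnCube ps) :
    IsProbabilityMeasure (cubeMeasure ps) := by
  have hint : IntegrableOn ps (unitCube d) := by
    by_contra h
    have := hps.integral_eq_one
    rw [integral_undef h] at this
    exact zero_ne_one this
  constructor
  rw [cubeMeasure, withDensity_apply _ MeasurableSet.univ, Measure.restrict_univ,
    ← ofReal_integral_eq_lintegral_ofReal hint, hps.integral_eq_one, ENNReal.ofReal_one]
  filter_upwards [ae_mem_unitCube] with s hs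
  exact hps.nonneg s hs

theorem cubeMeasure_absolutelyContinuous (ps : (Fin d → ℝ) → ℝ) :
    cubeMeasure ps ≪ volume.restrict (unitCube d) :=
  withDensity_absolutelyContinuous _ _

theorem IsDensityOnCube.integrable_iff {ps : (Fin d → ℝ) → ℝ} (hps : IsDensityOnCube ps)
    (g : (Fin d → ℝ) → ℝ) :
    Integrable g (cubeMeasure ps) ↔ IntegrableOn (fun s => g s * ps s) (unitCube d) := by
  rw [cubeMeasure, integrable_withDensity_iff_integrable_smul' hps.measurable.ennreal_ofReal
    (Filter.Eventually.of_forall fun _ => ENNReal.ofReal_lt_top)]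
  refine integrable_congr ?_
  filter_upwards [ae_mem_unitCube] with s hs
  rw [ENNReal.toReal_ofReal (hps.nonneg s hs), smul_eq_mul, mul_comm]

theorem IsDensityOnCube.integral_cubeMeasure {ps : (Fin d → ℝ) → ℝ} (hps : IsDensityOnCube ps)
    (g : (Fin d → ℝ) → ℝ) :
    ∫ s, g s ∂(cubeMeasure ps) = ∫ s in unitCube d, g s * ps s := by
  rw [cubeMeasure, integral_withDensity_eq_integral_toReal_smul hps.measurable.ennreal_ofReal
    (Filter.Eventually.of_forall fun _ => ENNReal.ofReal_lt_top)]
  refine integral_congr_ae ?_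
  filter_upwards [ae_mem_unitCube] with s hs
  rw [ENNReal.toReal_ofReal (hps.nonneg s hs), smul_eq_mul, mul_comm]

/-- A bound on the exponential integral of a nonnegative function controls its mean. -/
theorem integrable_and_integral_le_of_lintegral_exp_lt {α : Type*} [MeasurableSpace α]
    {Q : Measure α} [IsProbabilityMeasure Q] {C : α → ℝ} (hC : Measurable C)
    (hC0 : ∀ᵐ s ∂Q, 0 ≤ C s) {a δ : ℝ} (ha : 1 ≤ a)
    (h : ∫⁻ s, ENNReal.ofReal (Real.exp (a * C s)) ∂Q < ENNReal.ofReal (Real.exp (a * δ))) :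
    Integrable C Q ∧ ∫ s, C s ∂Q ≤ δ := by
  have hexp : Integrable (fun s => Real.exp (a * C s)) Q := by
    refine ⟨by fun_prop, ?_⟩
    rw [hasFiniteIntegral_iff_ofReal (Filter.Eventually.of_forall fun _ => (Real.exp_pos _).le)]
    exact h.trans ENNReal.ofReal_lt_top
  have hint : Integrable C Q := by
    refine hexp.mono' hC.aestronglyMeasurable ?_
    filter_upwards [hC0] with s hs
    rw [Real.norm_eq_abs, abs_of_nonneg hs]
    -- Here `1 ≤ a` gives `C ≤ a C ≤ exp (a C)`.
    have := Real.add_one_le_exp (a * C s)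
    nlinarith
  refine ⟨hint, ?_⟩
  rw [← ofReal_integral_eq_lintegral_ofReal hexp
    (Filter.Eventually.of_forall fun _ => (Real.exp_pos _).le),
    ENNReal.ofReal_lt_ofReal_iff (Real.exp_pos _)] at h
  -- Jensen's inequality, through the tangent line of the exponential at `a δ`.
  have htan : ∫ s, Real.exp (a * δ) * (1 + a * (C s - δ)) ∂Q ≤ ∫ s, Real.exp (a * C s) ∂Q := by
    refine integral_mono (by fun_prop) hexp fun s => ?_
    have h1 := Real.add_one_le_exp (a * (C s - δ))
    have h2 : Real.exp (a * C s) = Real.exp (a * δ) * Real.exp (a * (C s - δ)) := by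
      rw [← Real.exp_add]; congr 1; ring
    simp only [h2]
    gcongr
    linarith
  have hval : ∫ s, Real.exp (a * δ) * (1 + a * (C s - δ)) ∂Q =
      Real.exp (a * δ) * (1 + a * (∫ s, C s ∂Q - δ)) := by
    rw [integral_const_mul, integral_add (by fun_prop) (by fun_prop), integral_const_mul,
      integral_sub hint (by fun_prop)]
    simp
  rw [hval] at htan
  by_contra hcon
  push Not at hcon
  have h3 : 0 < a * (∫ s, C s ∂Q - δ) := mul_pos (by linarith) (by linarith)
  have h4 := Real.exp_pos (a * δ)
  nlinarith

/-- Exponential tail of the global contrast of the random smoothed grid-wise affine map. -/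
theorem one_sub_exp_le_measureReal_globalIMA_le (hpr : IsSphericallySymmetric pr)
    (hpr0 : pr {0} = 0) (hm : 2 ≤ m) (hε : 0 < ε) (hεw : ε < w) {l : ℕ} (hl0 : l ≠ 0)
    (hl : ∀ k < d, k = 0 ∨ 2 * (k + 2 * l) ≤ m) {ps : (Fin d → ℝ) → ℝ}
    (hps : IsDensityOnCube ps) (δ : ℝ) :
    1 - Real.exp (∑ k ∈ Finset.range d, 2 * (l : ℝ) * k / m - 2 * l * δ) ≤
      (gridLaw d w pr).real {J : GridColumns d m w |
        GlobalIMAWellDefined (smoothGridMap ε J) ps ∧ globalIMA (smoothGridMap ε J) ps ≤ δ} := by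
  have := hps.isProbabilityMeasure
  set B : ℝ := Real.exp (∑ k ∈ Finset.range d, 2 * (l : ℝ) * k / m) with hB
  set P := gridLaw d w pr with hP
  set S : Set (GridColumns d m w) := {J | GlobalIMAWellDefined (smoothGridMap ε J) ps ∧
    globalIMA (smoothGridMap ε J) ps ≤ δ} with hS
  have hcube : volume (unitCube d) < ⊤ := isCompact_Icc.measure_lt_top
  have hfin : IsFiniteMeasure (volume.restrict (unitCube d)) :=
    ⟨by rwa [Measure.restrict_apply_univ]⟩
  set Z : Measure (Fin d → ℝ) → GridColumns d m w → ENNReal :=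
    fun Q J => ∫⁻ s, contrastWeight l (gridJacobian ε J s) ∂Q with hZ
  have hZm : ∀ (Q : Measure (Fin d → ℝ)) [SFinite Q], Measurable (Z Q) := fun Q _ =>
    (measurable_contrastWeight_gridJacobian l).lintegral_prod_right'
  -- Full rank is required Lebesgue-almost everywhere, even where `ps` vanishes, so the moment bound
  -- is also applied to Lebesgue measure on the cube.
  have hrank : ∀ᵐ J ∂P, Z (volume.restrict (unitCube d)) J < ⊤ := by
    refine ae_lt_top (hZm _) (ne_of_lt ?_)
    refine (lintegral_lintegral_contrastWeight_le hpr hpr0 hm hε hεw hl _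
      ae_mem_unitCube).trans_lt ?_
    exact ENNReal.mul_lt_top ENNReal.ofReal_lt_top (measure_lt_top _ _)
  set bad : Set (GridColumns d m w) :=
    {J | ENNReal.ofReal (Real.exp (2 * l * δ)) ≤ Z (cubeMeasure ps) J} with hbad
  have hbadle : P.real bad ≤ Real.exp (∑ k ∈ Finset.range d, 2 * (l : ℝ) * k / m - 2 * l * δ) := by
    have h1 := mul_meas_ge_le_lintegral (μ := P) (hZm (cubeMeasure ps))
      (ENNReal.ofReal (Real.exp (2 * l * δ)))
    have h2 := lintegral_lintegral_contrastWeight_le hpr hpr0 hm hε hεw hl (cubeMeasure ps)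
      ((cubeMeasure_absolutelyContinuous ps).ae_le ae_mem_unitCube)
    rw [measure_univ, mul_one] at h2
    have h3 := ENNReal.toReal_mono ENNReal.ofReal_ne_top (h1.trans h2)
    rw [ENNReal.toReal_mul, ENNReal.toReal_ofReal (Real.exp_pos _).le,
      ENNReal.toReal_ofReal (Real.exp_pos _).le] at h3
    rw [Real.exp_sub, le_div_iff₀ (Real.exp_pos _), mul_comm]
    exact h3
  have hgood : ∀ J, Z (volume.restrict (unitCube d)) J < ⊤ → J ∉ bad → J ∈ S := by
    intro J hJ hJbad
    have hJm : Measurable fun s => gridJacobian ε J s := measurable_gridJacobian_right J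
    have hJbad : Z (cubeMeasure ps) J < ENNReal.ofReal (Real.exp (2 * l * δ)) := not_le.1 hJbad
    have hne : ∀ᵐ s ∂(volume.restrict (unitCube d)),
        ∀ k, gramSchmidt ℝ (gridJacobian ε J s) k ≠ 0 := by
      have hWm : Measurable fun s => contrastWeight l (gridJacobian ε J s) :=
        (measurable_contrastWeight l).comp hJm
      filter_upwards [ae_lt_top hWm hJ.ne] with s hs
      exact gramSchmidt_ne_zero_of_contrastWeight_ne_top hl0 hs.ne
    have hcol := ae_jacobianCol_eq hε J
    have hne' := (cubeMeasure_absolutelyContinuous ps).ae_le hne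
    have hexp : ∫⁻ s, ENNReal.ofReal
        (Real.exp (2 * l * columnContrast (gridJacobian ε J s))) ∂(cubeMeasure ps) <
        ENNReal.ofReal (Real.exp (2 * l * δ)) := by
      refine (Eq.le (lintegral_congr_ae ?_)).trans_lt hJbad
      filter_upwards [hne'] with s hs
      exact ofReal_exp_columnContrast l hs
    have hl1 : (1 : ℝ) ≤ l := by exact_mod_cast Nat.one_le_iff_ne_zero.2 hl0
    have hCm : Measurable fun s => columnContrast (gridJacobian ε J s) :=
      measurable_columnContrast.comp hJm
    obtain ⟨hint, hle⟩ := integrable_and_integral_le_of_lintegral_exp_lt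
      (C := fun s => columnContrast (gridJacobian ε J s)) hCm
      (by filter_upwards [hne'] with s hs using columnContrast_nonneg hs)
      (by linarith) hexp
    have hloc : ∀ᵐ s ∂(volume.restrict (unitCube d)),
        columnContrast (gridJacobian ε J s) * ps s = localIMA (smoothGridMap ε J) s * ps s := by
      filter_upwards [hcol] with s hs
      rw [localIMA_eq_columnContrast, hs]
    refine ⟨⟨?_, ?_⟩, ?_⟩
    · filter_upwards [hne, hcol] with s hs hs'
      rw [hs']
      exact linearIndependent_of_gramSchmidt_ne_zero hs
    · exact ((hps.integrable_iff _).1 hint).congr hloc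
    · rw [globalIMA, ← integral_congr_ae hloc]
      rw [hps.integral_cubeMeasure] at hle
      exact hle
  have hnull : P.real {J | ¬ Z (volume.restrict (unitCube d)) J < ⊤} = 0 := by
    rw [measureReal_def, ae_iff.1 hrank, ENNReal.toReal_zero]
  -- Measurability of `S` is not needed: the whole space is covered by `S`, a null set and `bad`,
  -- and subadditivity bounds the measure of `S` from below.
  have hcover : (Set.univ : Set (GridColumns d m w)) ⊆
      (S ∪ {J | ¬ Z (volume.restrict (unitCube d)) J < ⊤}) ∪ bad := by
    intro J _
    by_cases h1 : Z (volume.restrict (unitCube d)) J < ⊤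
    · by_cases h2 : J ∈ bad
      · exact Or.inr h2
      · exact Or.inl (Or.inl (hgood J h1 h2))
    · exact Or.inl (Or.inr h1)
  have h1 : 1 ≤ P.real ((S ∪ {J | ¬ Z (volume.restrict (unitCube d)) J < ⊤}) ∪ bad) := by
    have := measureReal_mono (μ := P) hcover
    simpa using this
  have h2 := measureReal_union_le (μ := P)
    (S ∪ {J | ¬ Z (volume.restrict (unitCube d)) J < ⊤}) bad
  have h3 := measureReal_union_le (μ := P) S {J | ¬ Z (volume.restrict (unitCube d)) J < ⊤}
  linarith

end GridContrast

/-! ### Choice of the moment order and conclusion -/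

/-- The order of the exponential moment used for given parameters, and the resulting exponent. -/
theorem exists_moment_order {δ₀ δ : ℝ} (hδ₀ : 0 < δ₀) {d m : ℕ} (hd : 0 < d) (hδ : 0 < δ)
    (hδδ₀ : δ < δ₀)
    (hlt : 2 * Real.log (d : ℝ) -
      1 / (100 * (δ₀ + δ₀ ^ 2)) * ((m : ℝ) - 1) * (δ ^ 2 / (d : ℝ) ^ 2) < 0) :
    2 ≤ m ∧ ∃ l : ℕ, l ≠ 0 ∧ (∀ k < d, k = 0 ∨ 2 * (k + 2 * l) ≤ m) ∧
      ∑ k ∈ Finset.range d, 2 * (l : ℝ) * k / m - 2 * l * δ ≤ 2 * Real.log (d : ℝ) -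
        1 / (100 * (δ₀ + δ₀ ^ 2)) * ((m : ℝ) - 1) * (δ ^ 2 / (d : ℝ) ^ 2) := by
  -- Chosen so that both `κ δ` and `κ δ²` are at most `1 / 100` for all `δ < δ₀`.
  set κ : ℝ := 1 / (100 * (δ₀ + δ₀ ^ 2)) with hκ
  have hκ0 : 0 < κ := by positivity
  have hκsum : κ * δ₀ + κ * δ₀ ^ 2 = 1 / 100 := by rw [hκ]; field_simp
  have hκ1 : κ * δ ≤ 1 / 100 := by
    have : κ * δ ≤ κ * δ₀ := by gcongr
    nlinarith [mul_pos hκ0 (pow_pos hδ₀ 2)]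
  have hκ2 : κ * δ ^ 2 ≤ 1 / 100 := by
    have : κ * δ ^ 2 ≤ κ * δ₀ ^ 2 := by gcongr
    nlinarith [mul_pos hκ0 hδ₀]
  have hd1 : (1 : ℝ) ≤ d := by exact_mod_cast hd
  have hlog : 0 ≤ Real.log (d : ℝ) := Real.log_nonneg hd1
  have hm : 2 ≤ m := by
    by_contra hm
    have hm' : (m : ℝ) ≤ 1 := by exact_mod_cast (by omega : m ≤ 1)
    have : κ * ((m : ℝ) - 1) * (δ ^ 2 / (d : ℝ) ^ 2) ≤ 0 :=
      mul_nonpos_of_nonpos_of_nonneg (mul_nonpos_of_nonneg_of_nonpos hκ0.le (by linarith))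
        (by positivity)
    linarith
  have hmr : (2 : ℝ) ≤ m := by exact_mod_cast hm
  -- The real order for which `2 y δ` is exactly the target exponent; the moment order is its
  -- ceiling.
  set y : ℝ := κ * ((m : ℝ) - 1) * δ / (2 * (d : ℝ) ^ 2) with hy
  have hy0 : 0 < y := by
    have : (0 : ℝ) < (m : ℝ) - 1 := by linarith
    positivity
  have hT : κ * ((m : ℝ) - 1) * (δ ^ 2 / (d : ℝ) ^ 2) = 2 * y * δ := by
    rw [hy]; field_simp
  have hyl : y ≤ (⌈y⌉₊ : ℝ) := Nat.le_ceil y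
  have hly : (⌈y⌉₊ : ℝ) < y + 1 := Nat.ceil_lt_add_one hy0.le
  refine ⟨hm, ⌈y⌉₊, (Nat.ceil_pos.2 hy0).ne', ?_⟩
  rw [hT] at hlt ⊢
  set l := ⌈y⌉₊ with hl
  have hmain : 2 * y * δ ≤ 2 * l * δ := by gcongr
  by_cases hd2 : d = 1
  · subst hd2
    refine ⟨fun k hk => Or.inl (by omega), ?_⟩
    simp
    linarith
  have hd2r : (2 : ℝ) ≤ d := by exact_mod_cast (by omega : 2 ≤ d)
  have hlog2 : 1 < 2 * Real.log (d : ℝ) := by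
    have := Real.log_le_log (by norm_num) hd2r
    have := Real.log_two_gt_d9
    linarith
  -- A negative exponent forces `2 y δ > 2 log d > 1`, hence `m` large compared with `d²`. This
  -- absorbs the rounding of `y` to `l`.
  have hmd : 100 * (d : ℝ) ^ 2 < (m : ℝ) - 1 := by
    have h1 : 1 < 2 * y * δ := by linarith
    have h2 : 2 * y * δ * (d : ℝ) ^ 2 = κ * δ ^ 2 * ((m : ℝ) - 1) := by
      rw [hy]; field_simp
    have h3 : κ * δ ^ 2 * ((m : ℝ) - 1) ≤ 1 / 100 * ((m : ℝ) - 1) := by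
      gcongr
      linarith
    have h4 : (d : ℝ) ^ 2 < 2 * y * δ * (d : ℝ) ^ 2 := lt_mul_of_one_lt_left (by positivity) h1
    linarith
  have hyd : y * (d : ℝ) ^ 2 ≤ 1 / 200 * ((m : ℝ) - 1) := by
    have h2 : y * (d : ℝ) ^ 2 = (κ * δ) * ((m : ℝ) - 1) / 2 := by
      rw [hy]; field_simp
    have h3 : κ * δ * ((m : ℝ) - 1) ≤ 1 / 100 * ((m : ℝ) - 1) := by
      gcongr
      linarith
    linarith
  constructor
  · intro k hk
    right
    have hkr : (k : ℝ) ≤ d := by exact_mod_cast hk.le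
    have h5 : y ≤ y * (d : ℝ) ^ 2 := le_mul_of_one_le_right hy0.le (by nlinarith)
    have : 2 * ((k : ℝ) + 2 * l) ≤ m := by nlinarith
    exact_mod_cast this
  -- The sum equals `l d (d - 1) / m ≤ (y + 1) d² / m`, and `y d²` and `d²` are at most `(m - 1) /
  -- 200` and `(m - 1) / 100`.
  · have hsum : ∑ k ∈ Finset.range d, 2 * (l : ℝ) * k / m ≤ 1 := by
      have h6 : ∑ k ∈ Finset.range d, (k : ℝ) * 2 = (d : ℝ) * (d - 1) := by
        rw [← Finset.sum_mul]
        have := Finset.sum_range_id_mul_two d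
        have h7 : ((∑ i ∈ Finset.range d, i : ℕ) : ℝ) * 2 = (d : ℝ) * ((d - 1 : ℕ) : ℝ) := by
          exact_mod_cast this
        rw [Nat.cast_sub hd] at h7
        push_cast at h7
        exact h7
      have h8 : ∑ k ∈ Finset.range d, 2 * (l : ℝ) * k / m = l * ((d : ℝ) * (d - 1)) / m := by
        rw [← h6, Finset.mul_sum, Finset.sum_div]
        exact Finset.sum_congr rfl fun k _ => by ring
      rw [h8, div_le_one (by linarith)]
      have h9 : (l : ℝ) * ((d : ℝ) * (d - 1)) ≤ (y + 1) * (d : ℝ) ^ 2 := by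
        gcongr
        nlinarith
      nlinarith
    linarith

theorem mainTheorem7 (δ₀ : ℝ) (hδ₀ : 0 < δ₀) :
    ∃ κ : ℝ, 0 < κ ∧
      ∀ (d m : ℕ), 0 < d → d ≤ m →
      ∀ (pr : Measure (EuclideanSpace ℝ (Fin m))) [IsProbabilityMeasure pr],
        IsSphericallySymmetric pr → pr {0} = 0 →
      ∀ (w ε : ℝ), 0 < ε → ε < w →
      ∀ (ps : (Fin d → ℝ) → ℝ), IsDensityOnCube ps →
      ∀ δ : ℝ, 0 < δ → δ < δ₀ →
        1 - min 1 (Real.exp (2 * Real.log (d : ℝ) - κ * ((m : ℝ) - 1) * (δ ^ 2 / (d : ℝ) ^ 2)))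
          ≤ (gridLaw d w pr).real
              {J : GridColumns d m w | GlobalIMAWellDefined (smoothGridMap ε J) ps ∧
                globalIMA (smoothGridMap ε J) ps ≤ δ} := by
  refine ⟨1 / (100 * (δ₀ + δ₀ ^ 2)), by positivity, ?_⟩
  intro d m hd _ pr _ hpr hpr0 w ε hε hεw ps hps δ hδ hδδ₀
  rcases le_or_gt 0 (2 * Real.log (d : ℝ) -
    1 / (100 * (δ₀ + δ₀ ^ 2)) * ((m : ℝ) - 1) * (δ ^ 2 / (d : ℝ) ^ 2)) with h | h
  · rw [min_eq_left (Real.one_le_exp h), sub_self]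
    exact measureReal_nonneg
  · obtain ⟨hm, l, hl0, hl, hexp⟩ := exists_moment_order hδ₀ hd hδ hδδ₀ h
    refine le_trans ?_ (one_sub_exp_le_measureReal_globalIMA_le hpr hpr0 hm hε hεw hl0 hl hps δ)
    rw [min_eq_right (Real.exp_le_one_iff.2 h.le)]
    exact sub_le_sub_left (Real.exp_le_exp.2 hexp) 1
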